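/- **Setting.** Let $\mathcal M$ be a smooth, connected, finite-dimensional Riemannian manifold without boundary, with geodesic distance $d$, and let $\mathcal X\subseteq\mathcal M$ be compact and geodesically convex, i.e. any two points of $\mathcal X$ are joined by a unique minimizing geodesic contained in $\mathcal X$. For $x,y\in\mathcal X$ let $\gamma_{x,y}:[0,1]\to\mathcal X$ be this geodesic ($\gamma_{x,y}(0)=x$, $\gamma_{x,y}(1)=y$), let $\mathrm{Exp}_x^{-1}(y):=\dot\gamma_{x,y}(0)\in T_x\mathcal M$, and let $\Gamma_x^y:T_x\mathcal M\to T_y\mathcal M$ be parallel transport along $\gamma_{x,y}$. Let $m\ge 1$ and let $\phi_1,\dots,\phi_m:\mathcal M\to\mathbb R$ (possibly nonconvex) be $L$-smooth on $\mathcal X$: each $\phi_i$ is differentiable at every point of $\mathcal X$, and $$\|\mathrm{grad}\,\phi_i(y)-\Gamma_x^y\,\mathrm{grad}\,\phi_i(x)\|\le L\,d(x,y)\qquad\text{for all }x,y\in\mathcal X.$$ Put $\Phi=\frac1m\sum_{i=1}^m\phi_i$, and let the Frank-Wolfe gap be $\mathcal G(x)=\max_{y\in\mathcal X}\langle \mathrm{Exp}_x^{-1}(y),-\mathrm{grad}\,\Phi(x)\rangle$.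 **Algorithm (SVR-RFW).** Given $x_0\in\mathcal X$, integers $K,S\ge 1$, a step size $\eta$, a batch size $b$, and an oracle which for $x\in\mathcal X$ and $g\in T_x\mathcal M$ returns some element of $\operatorname{argmin}_{z\in\mathcal X}\langle g,\mathrm{Exp}_x^{-1}(z)\rangle$, put $\tilde x^0=x_0$. For $s=0,\dots,S-1$ put $x_0^{s+1}=\tilde x^s$; for $k=0,\dots,K-1$ draw indices $i_1,\dots,i_b$ i.i.d. uniformly from $\{1,\dots,m\}$, independently of all other draws, and set $$g_k^{s+1}=\frac1b\sum_{l=1}^{b}\Bigl[\mathrm{grad}\,\phi_{i_l}(x_k^{s+1})-\Gamma_{\tilde x^s}^{x_k^{s+1}}\bigl(\mathrm{grad}\,\phi_{i_l}(\tilde x^s)-\mathrm{grad}\,\Phi(\tilde x^s)\bigr)\Bigr],$$ let $z_{k+1}^{s+1}\in\operatorname{argmin}_{z\in\mathcal X}\langle g_k^{s+1},\mathrm{Exp}_{x_k^{s+1}}^{-1}(z)\rangle$ be the point returned by the oracle, and set $x_{k+1}^{s+1}=\gamma_{x_k^{s+1},\,z_{k+1}^{s+1}}(\eta)$. Then put $\tilde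 x^{s+1}=x_K^{s+1}$. The output $\hat x$ is drawn uniformly at random from $\{x_k^{s+1}: 0\le s<S,\ 0\le k<K\}$ (uniformly over the pairs $(s,k)$), independently of the samples. **Theorem.** With step size $\eta=\frac1{\sqrt{KS}}$ and batch size $b=K^2$, the Frank-Wolfe gap of the output of SVR-RFW is integrable and satisfies $$\mathbb E\bigl[\mathcal G(\hat x)\bigr]\le\frac{\Phi(x_0)-\min_{\mathcal X}\Phi+L\,\mathrm{diam}(\mathcal X)^2}{\sqrt{KS}}.$$ In particular $\mathbb E[\mathcal G(\hat x)]=O\bigl(1/\sqrt{KS}\bigr)$, with a constant that does not depend on $K$, $S$, $m$, the samples or the choice of the minimizers. -/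

import Mathlib

open Set MeasureTheory ProbabilityTheory Bundle
open scoped Manifold ContDiff Topology

noncomputable section

namespace SvrRfw

section Geometry

variable {E : Type*} [NormedAddCommGroup E] [NormedSpace ℝ E]
  {M : Type*} [MetricSpace M] [ChartedSpace E M] [IsManifold 𝓘(ℝ, E) ∞ M]
  [RiemannianBundle (fun x : M => TangentSpace 𝓘(ℝ, E) x)]

/-- The metric tensor of `M` in the chart centred at `p`: the inner product of the constant
coordinate vector fields `u` and `w` at the point with coordinates `e`. -/
def chartMetric (p : M) (e u w : E) : ℝ :=
  let x : M := (extChartAt 𝓘(ℝ, E) p).symm e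
  let triv := trivializationAt E (TangentSpace 𝓘(ℝ, E) : M → Type _) p
  inner ℝ (triv.symmL ℝ x u) (triv.symmL ℝ x w)

/-- Christoffel symbols of the first kind at `p`, in the chart centred at `p`:
`⟨∇_u v, w⟩ = (∂_u g(v, w) + ∂_v g(u, w) - ∂_w g(u, v)) / 2` for constant coordinate fields,
where `∇` is the Levi-Civita connection. -/
def christoffel (p : M) (u v w : E) : ℝ :=
  let e₀ : E := extChartAt 𝓘(ℝ, E) p p
  (fderiv ℝ (fun e => chartMetric p e v w) e₀ u
    + fderiv ℝ (fun e => chartMetric p e u w) e₀ v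
    - fderiv ℝ (fun e => chartMetric p e u v) e₀ w) / 2

/-- The vector field `V` along the curve `γ : [0, 1] → M` is parallel. At each time `t₀`, with
`c'` and `v'` the derivatives at `t₀` of the coordinates of `γ` and of `V` in the chart centred at
`γ t₀`, the covariant derivative `v' + ∇_{c'} V` (Levi-Civita connection) is zero; this is tested
against all tangent vectors `w`. In the chart centred at `γ t₀` the coordinates of a tangent
vector at `γ t₀` are the vector itself. -/
def IsParallelAlong (γ : ℝ → M) (V : ∀ t, TangentSpace 𝓘(ℝ, E) (γ t)) : Prop :=
  ∀ t₀ ∈ Icc (0 : ℝ) 1, ∃ c' v' : TangentSpace 𝓘(ℝ, E) (γ t₀),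
    HasDerivWithinAt (F := E) (fun t => extChartAt 𝓘(ℝ, E) (γ t₀) (γ t)) c' (Icc 0 1) t₀ ∧
    HasDerivWithinAt (F := E)
      (fun t => (trivializationAt E (TangentSpace 𝓘(ℝ, E) : M → Type _)
        (γ t₀)).continuousLinearMapAt ℝ (γ t) (V t)) v' (Icc 0 1) t₀ ∧
    ∀ w : TangentSpace 𝓘(ℝ, E) (γ t₀), inner ℝ v' w + christoffel (E := E) (γ t₀) c' (V t₀) w = 0

/-- The velocity of the curve `γ : [0, 1] → M` (one-sided at the end points). -/
def velocity (γ : ℝ → M) (t : ℝ) : TangentSpace 𝓘(ℝ, E) (γ t) :=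
  mfderivWithin 𝓘(ℝ, ℝ) 𝓘(ℝ, E) γ (Icc 0 1) t (1 : ℝ)

variable (E) in
/-- `γ : [0, 1] → M` is a geodesic: a smooth curve whose velocity is parallel. -/
def IsGeodesic (γ : ℝ → M) : Prop :=
  ContMDiffOn 𝓘(ℝ, ℝ) 𝓘(ℝ, E) ∞ γ (Icc 0 1) ∧ IsParallelAlong (E := E) γ (velocity γ)

variable (E) in
/-- `γ : [0, 1] → M` is a minimizing geodesic from `x` to `y` that stays in `X`. A geodesic has
constant speed, so its length is the norm of its initial velocity. -/
structure IsMinGeodesic (X : Set M) (x y : M) (γ : ℝ → M) : Prop where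
  geodesic : IsGeodesic E γ
  left : γ 0 = x
  right : γ 1 = y
  mapsTo : MapsTo γ (Icc 0 1) X
  length_eq : ‖(velocity γ 0 : TangentSpace 𝓘(ℝ, E) (γ 0))‖ = dist x y

variable (E) in
/-- `X` is geodesically convex: any two of its points are joined by a minimizing geodesic inside
`X`, and this geodesic is unique. -/
def IsGeodesicallyConvex (X : Set M) : Prop :=
  ∀ x ∈ X, ∀ y ∈ X, ∃ γ, IsMinGeodesic E X x y γ ∧
    ∀ γ', IsMinGeodesic E X x y γ' → EqOn γ' γ (Icc 0 1)

open Classical in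
variable (E) in
/-- The geodesic map: the minimizing geodesic in `X` from `x` to `y`, parametrized by `[0, 1]`
(a constant curve if there is none). -/
def geod (X : Set M) (x y : M) : ℝ → M :=
  if h : ∃ γ, IsMinGeodesic E X x y γ then h.choose else fun _ => x

/-- The inverse exponential map `Exp_x⁻¹(y)` on `X`: the initial velocity of the geodesic from `x`
to `y`. -/
def expInv (X : Set M) (x y : M) : TangentSpace 𝓘(ℝ, E) x :=
  (velocity (geod E X x y) 0 : E)

open Classical in
/-- Parallel transport along `γ : [0, 1] → M`: the linear isometry from the tangent space at `γ 0`
to the one at `γ 1` that sends `V 0` to `V 1` for every parallel field `V` along `γ`. (Each vector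
at `γ 0` is the initial value of a parallel field, so there is only one such map.) -/
def transportAlong (γ : ℝ → M) (v : TangentSpace 𝓘(ℝ, E) (γ 0)) : TangentSpace 𝓘(ℝ, E) (γ 1) :=
  if h : ∃ A : TangentSpace 𝓘(ℝ, E) (γ 0) ≃ₗᵢ[ℝ] TangentSpace 𝓘(ℝ, E) (γ 1),
    ∀ V : ∀ t, TangentSpace 𝓘(ℝ, E) (γ t), IsParallelAlong γ V → A (V 0) = V 1
  then h.choose v else 0

/-- Parallel transport `Γ_x^y` from the tangent space at `x` to the one at `y`, along the geodesic
from `x` to `y`. -/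
def transport (X : Set M) (x y : M) (v : TangentSpace 𝓘(ℝ, E) x) : TangentSpace 𝓘(ℝ, E) y :=
  (transportAlong (E := E) (geod E X x y) (v : E) : E)

variable [FiniteDimensional ℝ E]

/-- The Riemannian gradient of `φ` at `x`: the tangent vector that represents the differential of
`φ` at `x`. -/
def grad (φ : M → ℝ) (x : M) : TangentSpace 𝓘(ℝ, E) x :=
  haveI : FiniteDimensional ℝ (TangentSpace 𝓘(ℝ, E) x) := inferInstanceAs (FiniteDimensional ℝ E)
  haveI : CompleteSpace (TangentSpace 𝓘(ℝ, E) x) := FiniteDimensional.complete ℝ _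
  (InnerProductSpace.toDual ℝ (TangentSpace 𝓘(ℝ, E) x)).symm
    (mfderiv 𝓘(ℝ, E) 𝓘(ℝ, ℝ) φ x : TangentSpace 𝓘(ℝ, E) x →L[ℝ] ℝ)

variable (E) in
/-- `φ` is (geodesically) `L`-smooth on `X`. -/
def IsLSmoothOn (L : ℝ) (X : Set M) (φ : M → ℝ) : Prop :=
  (∀ x ∈ X, MDifferentiableAt 𝓘(ℝ, E) 𝓘(ℝ, ℝ) φ x) ∧
  ∀ x ∈ X, ∀ y ∈ X,
    ‖(grad φ y - transport X x y (grad φ x) : TangentSpace 𝓘(ℝ, E) y)‖ ≤ L * dist x y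

/-- The finite-sum objective `Φ = (1/m) ∑ φᵢ`. -/
def objective {m : ℕ} (φ : Fin m → M → ℝ) (x : M) : ℝ :=
  (1 / m : ℝ) * ∑ i, φ i x

variable (E) in
/-- The Frank-Wolfe gap `max_{y ∈ X} ⟨Exp_x⁻¹(y), -grad Φ(x)⟩`. -/
def fwGap (X : Set M) (Φ : M → ℝ) (x : M) : ℝ :=
  sSup ((fun y => inner ℝ (expInv X x y : TangentSpace 𝓘(ℝ, E) x) (-grad Φ x)) '' X)

/-- A Riemannian linear optimization oracle for `X`: for `x ∈ X` and a tangent vector `g` at `x`,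
it returns a minimizer of `z ↦ ⟨g, Exp_x⁻¹(z)⟩` over `X` (any minimizer). -/
def IsRLO (X : Set M) (rlo : ∀ x : M, TangentSpace 𝓘(ℝ, E) x → M) : Prop :=
  ∀ x ∈ X, ∀ g : TangentSpace 𝓘(ℝ, E) x, rlo x g ∈ X ∧
    ∀ z ∈ X, inner ℝ g (expInv X x (rlo x g)) ≤ inner ℝ g (expInv X x z)

/-- The variance-reduced gradient at `x` with snapshot point `xs` and minibatch
`i 0, …, i (b - 1)`. -/
def vrGrad {m : ℕ} (X : Set M) (φ : Fin m → M → ℝ) (xs x : M) (b : ℕ) (i : ℕ → Fin m) :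
    TangentSpace 𝓘(ℝ, E) x :=
  (1 / b : ℝ) • ∑ j ∈ Finset.range b,
    (grad (φ (i j)) x - transport X xs x (grad (φ (i j)) xs - grad (objective φ) xs))

/-- The inner iterates of one epoch with snapshot point `xs`: step size `η`, batch size `b`,
`I k` the minibatch of iteration `k`. -/
def epoch {m : ℕ} (X : Set M) (φ : Fin m → M → ℝ) (rlo : ∀ x : M, TangentSpace 𝓘(ℝ, E) x → M)
    (η : ℝ) (b : ℕ) (I : ℕ → ℕ → Fin m) (xs : M) : ℕ → M
  | 0 => xs
  | k + 1 =>
    let x := epoch X φ rlo η b I xs k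
    geod E X x (rlo x (vrGrad X φ xs x b (I k))) η

/-- The snapshot points: the start of epoch `0` is `x₀`, and each epoch of `K` steps hands its last
iterate to the next one. `I s k` is the minibatch of iteration `k` in epoch `s`. -/
def snapshot {m : ℕ} (X : Set M) (φ : Fin m → M → ℝ) (rlo : ∀ x : M, TangentSpace 𝓘(ℝ, E) x → M)
    (η : ℝ) (b K : ℕ) (I : ℕ → ℕ → ℕ → Fin m) (x₀ : M) : ℕ → M
  | 0 => x₀
  | s + 1 => epoch X φ rlo η b (I s) (snapshot X φ rlo η b K I x₀ s) K

/-- The iterate `k` of epoch `s` of SVR-RFW. -/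
def iterate {m : ℕ} (X : Set M) (φ : Fin m → M → ℝ) (rlo : ∀ x : M, TangentSpace 𝓘(ℝ, E) x → M)
    (η : ℝ) (b K : ℕ) (I : ℕ → ℕ → ℕ → Fin m) (x₀ : M) (s k : ℕ) : M :=
  epoch X φ rlo η b (I s) (snapshot X φ rlo η b K I x₀ s) k

end Geometry

/-- The randomness of SVR-RFW with `S` epochs of `K` steps and batch size `b`: the sampled indices
`idx s k j` (`s < S`, `k < K`, `j < b`) are i.i.d. uniform on the `m` components, and the output
position `out` is uniform on the `S * K` pairs (epoch, step) and independent of the samples. -/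
structure IsSampling {Ω : Type*} [MeasurableSpace Ω] (P : Measure Ω) (m S K b : ℕ)
    (idx : ℕ → ℕ → ℕ → Ω → Fin m) (out : Ω → Fin S × Fin K) : Prop where
  measurable_idx : ∀ s < S, ∀ k < K, ∀ j < b, Measurable (idx s k j)
  uniform_idx : ∀ s < S, ∀ k < K, ∀ j < b, ∀ i : Fin m, P.real {a | idx s k j a = i} = 1 / m
  indep_idx : iIndepFun (fun (p : Fin S × Fin K × Fin b) => idx p.1 p.2.1 p.2.2) P
  measurable_out : Measurable out
  uniform_out : ∀ p : Fin S × Fin K, P.real {a | out a = p} = 1 / (S * K)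
  indep_out : IndepFun out (fun a (p : Fin S × Fin K × Fin b) => idx p.1 p.2.1 p.2.2 a) P

end SvrRfw

end

/-! Write D for the diameter of `X`. Along a geodesic of `X` an `L`-smooth Φ satisfies the usual
quadratic upper bound (`IsLSmoothOn.descent`), so a Frank-Wolfe step towards z = rlo(g) changes Φ by
at most η⟨grad Φ, Exp⁻¹(z)⟩ + LD²η²/2. Let y be the oracle's answer for the exact gradient.
Optimality of z for g gives ⟨grad Φ, Exp⁻¹(z)⟩ ≤ -gap + ⟨g - grad Φ, Exp⁻¹(y)⟩ + D‖g - grad Φ‖. The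
middle term has mean zero, because y does not depend on the minibatch. The last one has mean at most
LD·d(snapshot, x)/√b by the variance computation for a minibatch (`sum_tnorm_tvrGrad_sub_le`).

After k steps of an epoch the iterate is within kηD of its snapshot, and √b = K, so step k loses at
most LD²η²(k/K + 1/2). These losses sum to at most LD²η²K per epoch, hence LD²η²KS = LD² in all.
Telescoping Φ and dividing by ηKS = √(KS) gives the bound.

The geometric input is that the Levi-Civita connection is metric. Inner products of parallel fields
are therefore constant, which gives geodesics constant speed and makes parallel transport a linear
isometry carrying velocity to velocity.

The algorithm has finitely many random outcomes, so expectations are finite averages. Conditioning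
on the past becomes resampling of one minibatch (`sum_sum_update`), and no measurability of the
oracle, the geodesics or the gap is needed. -/

noncomputable section

namespace SvrRfw

/-! ### Tangent-space inner products, written on the model space -/

section Fiber

variable {E : Type*} [NormedAddCommGroup E] [NormedSpace ℝ E]
  {M : Type*} [MetricSpace M] [ChartedSpace E M]
  [RiemannianBundle (fun x : M => TangentSpace 𝓘(ℝ, E) x)]

/-- The inner product of the tangent space at `x`, on the model space. -/
def tip (x : M) (u w : E) : ℝ := inner ℝ (E := TangentSpace 𝓘(ℝ, E) x) u w

/-- The norm of the tangent space at `x`, on the model space. -/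
def tnorm (x : M) (u : E) : ℝ := norm (E := TangentSpace 𝓘(ℝ, E) x) u

theorem tip_comm (x : M) (u w : E) : tip x u w = tip x w u :=
  real_inner_comm (F := TangentSpace 𝓘(ℝ, E) x) w u

theorem tip_smul_left (x : M) (c : ℝ) (u w : E) : tip x (c • u) w = c * tip x u w :=
  real_inner_smul_left (F := TangentSpace 𝓘(ℝ, E) x) u w c

theorem tip_smul_right (x : M) (c : ℝ) (u w : E) : tip x u (c • w) = c * tip x u w :=
  real_inner_smul_right (F := TangentSpace 𝓘(ℝ, E) x) u w c

theorem tip_neg_right (x : M) (u w : E) : tip x u (-w) = -tip x u w :=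
  inner_neg_right (E := TangentSpace 𝓘(ℝ, E) x) u w

theorem tip_sub_left (x : M) (u u' w : E) : tip x (u - u') w = tip x u w - tip x u' w :=
  inner_sub_left (E := TangentSpace 𝓘(ℝ, E) x) u u' w

theorem tip_sum_left {ι : Type*} (x : M) (s : Finset ι) (f : ι → E) (w : E) :
    tip x (∑ i ∈ s, f i) w = ∑ i ∈ s, tip x (f i) w :=
  sum_inner (E := TangentSpace 𝓘(ℝ, E) x) s f w

theorem tip_sum_right {ι : Type*} (x : M) (s : Finset ι) (f : ι → E) (w : E) :
    tip x w (∑ i ∈ s, f i) = ∑ i ∈ s, tip x w (f i) :=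
  inner_sum (E := TangentSpace 𝓘(ℝ, E) x) s f w

theorem tip_self (x : M) (u : E) : tip x u u = tnorm x u ^ 2 :=
  real_inner_self_eq_norm_sq (F := TangentSpace 𝓘(ℝ, E) x) u

theorem tnorm_nonneg (x : M) (u : E) : 0 ≤ tnorm x u :=
  norm_nonneg (E := TangentSpace 𝓘(ℝ, E) x) u

theorem tnorm_smul (x : M) (c : ℝ) (u : E) : tnorm x (c • u) = |c| * tnorm x u :=
  norm_smul (β := TangentSpace 𝓘(ℝ, E) x) c u

theorem tnorm_neg (x : M) (u : E) : tnorm x (-u) = tnorm x u :=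
  norm_neg (E := TangentSpace 𝓘(ℝ, E) x) u

theorem tip_le (x : M) (u w : E) : tip x u w ≤ tnorm x u * tnorm x w :=
  real_inner_le_norm (F := TangentSpace 𝓘(ℝ, E) x) u w

theorem tip_left_injective (x : M) {u v : E} (h : ∀ w : E, tip x u w = tip x v w) : u = v :=
  ext_inner_right (E := TangentSpace 𝓘(ℝ, E) x) ℝ h

theorem tnorm_sum_le {ι : Type*} (x : M) (s : Finset ι) (f : ι → E) :
    tnorm x (∑ i ∈ s, f i) ≤ ∑ i ∈ s, tnorm x (f i) :=
  norm_sum_le (E := TangentSpace 𝓘(ℝ, E) x) s f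

end Fiber

/-! ### The metric tensor in charts -/

section Chart

variable {E : Type*} [NormedAddCommGroup E] [NormedSpace ℝ E]
  {M : Type*} [MetricSpace M] [ChartedSpace E M] [IsManifold 𝓘(ℝ, E) ∞ M]

/-- The tangent vector at `x` with given coordinates in the chart centred at `p`. -/
def frame (p x : M) : E →L[ℝ] E :=
  (trivializationAt E (TangentSpace 𝓘(ℝ, E) : M → Type _) p).symmL ℝ x

/-- The coordinates of a tangent vector at `x` in the chart centred at `p`. -/
def coframe (p x : M) : E →L[ℝ] E :=
  (trivializationAt E (TangentSpace 𝓘(ℝ, E) : M → Type _) p).continuousLinearMapAt ℝ x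

theorem frame_self (p : M) (u : E) : frame p p u = u := by
  unfold frame
  rw [TangentBundle.symmL_trivializationAt_eq_core (mem_chart_source E p)]
  exact (tangentBundleCore 𝓘(ℝ, E) M).coordChange_self (achart E p) p (mem_chart_source E p) u

theorem coframe_self (p : M) (u : E) : coframe p p u = u := by
  unfold coframe
  rw [TangentBundle.continuousLinearMapAt_trivializationAt_eq_core (mem_chart_source E p)]
  exact (tangentBundleCore 𝓘(ℝ, E) M).coordChange_self (achart E p) p (mem_chart_source E p) u

theorem frame_coframe {p x : M} (hx : x ∈ (chartAt E p).source) (u : E) :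
    frame p x (coframe p x u) = u :=
  Trivialization.symmL_continuousLinearMapAt (R := ℝ)
    (trivializationAt E (TangentSpace 𝓘(ℝ, E) : M → Type _) p) hx u

variable [RiemannianBundle (fun x : M => TangentSpace 𝓘(ℝ, E) x)]

theorem chartMetric_eq (p : M) (e u w : E) :
    chartMetric p e u w = tip ((extChartAt 𝓘(ℝ, E) p).symm e)
      (frame p ((extChartAt 𝓘(ℝ, E) p).symm e) u)
      (frame p ((extChartAt 𝓘(ℝ, E) p).symm e) w) := rfl

theorem chartMetric_self (p : M) (u w : E) :
    chartMetric p (extChartAt 𝓘(ℝ, E) p p) u w = tip p u w := by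
  rw [chartMetric_eq, extChartAt_to_inv p, frame_self, frame_self]

theorem chartMetric_smul_left (p : M) (e : E) (c : ℝ) (u w : E) :
    chartMetric p e (c • u) w = c * chartMetric p e u w := by
  simp only [chartMetric_eq, map_smul, tip_smul_left]

theorem chartMetric_comm (p : M) (e u w : E) :
    chartMetric p e u w = chartMetric p e w u := by
  simp only [chartMetric_eq]
  exact tip_comm _ _ _

theorem chartMetric_smul_right (p : M) (e : E) (c : ℝ) (u w : E) :
    chartMetric p e u (c • w) = c * chartMetric p e u w := by
  simp only [chartMetric_eq, map_smul, tip_smul_right]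

theorem chartMetric_sum {ι κ : Type*} (p : M) (e : E) (s : Finset ι) (t : Finset κ)
    (a : ι → ℝ) (b : κ → ℝ) (u : ι → E) (w : κ → E) :
    chartMetric p e (∑ i ∈ s, a i • u i) (∑ j ∈ t, b j • w j)
      = ∑ i ∈ s, ∑ j ∈ t, a i * (b j * chartMetric p e (u i) (w j)) := by
  simp only [chartMetric_eq, map_sum, map_smul, tip_sum_left, tip_sum_right, tip_smul_left,
    tip_smul_right, Finset.mul_sum]
  rw [Finset.sum_comm]
  exact Finset.sum_congr rfl fun i _ => Finset.sum_congr rfl fun j _ => by ring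

theorem chartMetric_coframe {p x : M} (hx : x ∈ (chartAt E p).source) (v w : E) :
    chartMetric p (extChartAt 𝓘(ℝ, E) p x) (coframe p x v) (coframe p x w) = tip x v w := by
  have h : (extChartAt 𝓘(ℝ, E) p).symm (extChartAt 𝓘(ℝ, E) p x) = x :=
    (extChartAt 𝓘(ℝ, E) p).left_inv (by simpa using hx)
  rw [chartMetric_eq, h, frame_coframe hx, frame_coframe hx]

variable [IsContMDiffRiemannianBundle 𝓘(ℝ, E) ∞ E (fun x : M => TangentSpace 𝓘(ℝ, E) x)]

/-- A constant coordinate field has constant second component in the trivialization at `p`, hence is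
a differentiable section; pairing two of them with the smooth bundle metric stays differentiable. -/
theorem differentiableAt_chartMetric (p : M) (u w : E) :
    DifferentiableAt ℝ (fun e => chartMetric p e u w) (extChartAt 𝓘(ℝ, E) p p) := by
  have : ContMDiffVectorBundle 1 E (TangentSpace 𝓘(ℝ, E) : M → Type _) 𝓘(ℝ, E) := inferInstance
  have hs : ∀ u : E, MDifferentiableAt 𝓘(ℝ, E) (𝓘(ℝ, E).prod 𝓘(ℝ, E)) (fun e : E =>
      (⟨(extChartAt 𝓘(ℝ, E) p).symm e, (frame p ((extChartAt 𝓘(ℝ, E) p).symm e) : E →L[ℝ] E) u⟩ :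
        TotalSpace E (fun x : M => TangentSpace 𝓘(ℝ, E) x)))
      (extChartAt 𝓘(ℝ, E) p p) := by
    intro u
    have h1 : MDifferentiableAt 𝓘(ℝ, E) 𝓘(ℝ, E) (extChartAt 𝓘(ℝ, E) p).symm
        (extChartAt 𝓘(ℝ, E) p p) := by
      have := (contMDiffOn_extChartAt_symm (I := 𝓘(ℝ, E)) (n := 1) p).contMDiffAt
        (x := extChartAt 𝓘(ℝ, E) p p) (extChartAt_target_mem_nhds p)
      exact this.mdifferentiableAt one_ne_zero
    rw [mdifferentiableAt_totalSpace]
    refine ⟨h1, ?_⟩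
    refine (mdifferentiableAt_const (c := u)).congr_of_eventuallyEq ?_
    have h0 : (extChartAt 𝓘(ℝ, E) p).symm (extChartAt 𝓘(ℝ, E) p p) = p := extChartAt_to_inv p
    filter_upwards [extChartAt_target_mem_nhds (I := 𝓘(ℝ, E)) p] with e he
    have hx : (extChartAt 𝓘(ℝ, E) p).symm e ∈ (chartAt E p).source := by
      simpa using (extChartAt 𝓘(ℝ, E) p).map_target he
    change (trivializationAt E (fun x : M => TangentSpace 𝓘(ℝ, E) x)
      ((extChartAt 𝓘(ℝ, E) p).symm (extChartAt 𝓘(ℝ, E) p p)) _).2 = u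
    rw [h0]
    have := Trivialization.continuousLinearMapAt_symmL (R := ℝ)
      (trivializationAt E (TangentSpace 𝓘(ℝ, E) : M → Type _) p) hx u
    exact (Trivialization.continuousLinearMapAt_apply_of_mem (R := ℝ)
      (trivializationAt E (TangentSpace 𝓘(ℝ, E) : M → Type _) p) hx _).symm.trans this
  have := MDifferentiableAt.inner_bundle (E := fun x : M => TangentSpace 𝓘(ℝ, E) x) (hs u) (hs w)
  exact this.differentiableAt

end Chart

/-! ### Metric compatibility of the Levi-Civita connection -/

section Parallel

variable {E : Type*} [NormedAddCommGroup E] [NormedSpace ℝ E]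
  {M : Type*} [MetricSpace M] [ChartedSpace E M] [IsManifold 𝓘(ℝ, E) ∞ M]
  [RiemannianBundle (fun x : M => TangentSpace 𝓘(ℝ, E) x)]

theorem isParallelAlong_iff (γ : ℝ → M) (V : ℝ → E) :
    IsParallelAlong (E := E) γ V ↔ ∀ t₀ ∈ Icc (0 : ℝ) 1, ∃ c' v' : E,
      HasDerivWithinAt (fun t => extChartAt 𝓘(ℝ, E) (γ t₀) (γ t)) c' (Icc 0 1) t₀ ∧
      HasDerivWithinAt (fun t => (coframe (γ t₀) (γ t) : E →L[ℝ] E) (V t)) v' (Icc 0 1) t₀ ∧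
      ∀ w : E, tip (γ t₀) v' w + christoffel (E := E) (γ t₀) c' (V t₀) w = 0 :=
  Iff.rfl

/-- Metric compatibility in coordinates: in the Koszul formula the two terms differentiating along
`v` and `w` cancel when these are exchanged. -/
theorem christoffel_add_swap (p : M) (c v w : E) :
    christoffel (E := E) p c v w + christoffel (E := E) p c w v
      = fderiv ℝ (fun e => chartMetric p e v w) (extChartAt 𝓘(ℝ, E) p p) c := by
  have h : (fun e => chartMetric p e w v) = fun e => chartMetric p e v w :=
    funext fun e => chartMetric_comm p e w v
  unfold christoffel
  simp only [h]
  ring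

variable [FiniteDimensional ℝ E]
  [IsContMDiffRiemannianBundle 𝓘(ℝ, E) ∞ E (fun x : M => TangentSpace 𝓘(ℝ, E) x)]

theorem hasDerivWithinAt_chartMetric (p : M) {s : Set ℝ} {t₀ : ℝ} {c v w : ℝ → E} {c' v' w' : E}
    (hc : HasDerivWithinAt c c' s t₀) (h0 : c t₀ = extChartAt 𝓘(ℝ, E) p p)
    (hv : HasDerivWithinAt v v' s t₀) (hw : HasDerivWithinAt w w' s t₀) :
    HasDerivWithinAt (fun t => chartMetric p (c t) (v t) (w t))
      (fderiv ℝ (fun e => chartMetric p e (v t₀) (w t₀)) (extChartAt 𝓘(ℝ, E) p p) c'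
        + chartMetric p (c t₀) v' (w t₀) + chartMetric p (c t₀) (v t₀) w') s t₀ := by
  -- Differentiability of the metric is known only for fixed pairs of vectors. Expanding in a basis
  -- reduces the product rule to the finitely many scalar entries of the metric tensor.
  let b := Module.finBasis ℝ E
  let a : Fin (Module.finrank ℝ E) → E →L[ℝ] ℝ := fun i =>
    LinearMap.toContinuousLinearMap (b.coord i)
  have hexp : ∀ u : E, u = ∑ i, a i u • b i := fun u => (b.sum_repr u).symm
  have hmet : ∀ e u u' : E, chartMetric p e u u'
      = ∑ i, ∑ j, a i u * (a j u' * chartMetric p e (b i) (b j)) := by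
    intro e u u'
    conv_lhs => rw [hexp u, hexp u']
    rw [chartMetric_sum]
  have hg : ∀ i j, HasFDerivAt (fun e => chartMetric p e (b i) (b j))
      (fderiv ℝ (fun e => chartMetric p e (b i) (b j)) (extChartAt 𝓘(ℝ, E) p p))
      (extChartAt 𝓘(ℝ, E) p p) := fun i j => (differentiableAt_chartMetric p _ _).hasFDerivAt
  have hfd : fderiv ℝ (fun e => chartMetric p e (v t₀) (w t₀)) (extChartAt 𝓘(ℝ, E) p p) c'
      = ∑ i, ∑ j, a i (v t₀) * (a j (w t₀) *
        fderiv ℝ (fun e => chartMetric p e (b i) (b j)) (extChartAt 𝓘(ℝ, E) p p) c') := by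
    have : HasFDerivAt (fun e => chartMetric p e (v t₀) (w t₀))
        (∑ i, ∑ j, a i (v t₀) • (a j (w t₀) •
          fderiv ℝ (fun e => chartMetric p e (b i) (b j)) (extChartAt 𝓘(ℝ, E) p p)))
        (extChartAt 𝓘(ℝ, E) p p) := by
      simp_rw [hmet _ (v t₀) (w t₀)]
      exact HasFDerivAt.fun_sum fun i _ => HasFDerivAt.fun_sum fun j _ =>
        ((hg i j).const_mul _).const_mul _
    rw [this.fderiv]
    simp
  rw [hfd, hmet _ v' (w t₀), hmet _ (v t₀) w', ← Finset.sum_add_distrib, ← Finset.sum_add_distrib]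
  simp_rw [← Finset.sum_add_distrib]
  have hgc : ∀ i j, HasDerivWithinAt (fun t => chartMetric p (c t) (b i) (b j))
      (fderiv ℝ (fun e => chartMetric p e (b i) (b j)) (extChartAt 𝓘(ℝ, E) p p) c') s t₀ := by
    intro i j
    have := hg i j
    rw [← h0] at this ⊢
    exact this.comp_hasDerivWithinAt t₀ hc
  have hav : ∀ i, HasDerivWithinAt (fun t => a i (v t)) (a i v') s t₀ := fun i =>
    (a i).hasFDerivAt.comp_hasDerivWithinAt t₀ hv
  have haw : ∀ i, HasDerivWithinAt (fun t => a i (w t)) (a i w') s t₀ := fun i =>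
    (a i).hasFDerivAt.comp_hasDerivWithinAt t₀ hw
  have hfun : (fun t => chartMetric p (c t) (v t) (w t)) = fun t =>
      ∑ i, ∑ j, a i (v t) * (a j (w t) * chartMetric p (c t) (b i) (b j)) := by
    funext t
    exact hmet _ _ _
  rw [hfun]
  refine HasDerivWithinAt.fun_sum fun i _ => HasDerivWithinAt.fun_sum fun j _ => ?_
  refine ((hav i).mul ((haw j).mul (hgc i j))).congr_deriv ?_
  simp only [Pi.mul_apply]
  ring

/-- The Levi-Civita connection is metric: the inner product of two parallel fields is constant. -/
theorem hasDerivWithinAt_tip_of_isParallelAlong {γ : ℝ → M} (hγ : ContinuousOn γ (Icc 0 1))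
    {V W : ℝ → E} (hV : IsParallelAlong (E := E) γ V) (hW : IsParallelAlong (E := E) γ W)
    {t₀ : ℝ} (ht : t₀ ∈ Icc (0 : ℝ) 1) :
    HasDerivWithinAt (fun t => tip (γ t) (V t) (W t)) 0 (Icc 0 1) t₀ := by
  obtain ⟨c', v', hc, hv, hv0⟩ := (isParallelAlong_iff γ V).1 hV t₀ ht
  obtain ⟨c'', w', hc'', hw, hw0⟩ := (isParallelAlong_iff γ W).1 hW t₀ ht
  obtain rfl : c' = c'' := (uniqueDiffOn_Icc zero_lt_one t₀ ht).eq_deriv _ hc hc''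
  have hD := hasDerivWithinAt_chartMetric (γ t₀) hc rfl hv hw
  have hev : (fun t => tip (γ t) (V t) (W t)) =ᶠ[𝓝[Icc 0 1] t₀] fun t =>
      chartMetric (γ t₀) (extChartAt 𝓘(ℝ, E) (γ t₀) (γ t))
        ((coframe (γ t₀) (γ t) : E →L[ℝ] E) (V t)) ((coframe (γ t₀) (γ t) : E →L[ℝ] E) (W t)) := by
    filter_upwards [(hγ t₀ ht).preimage_mem_nhdsWithin
      ((chartAt E (γ t₀)).open_source.mem_nhds (mem_chart_source E (γ t₀)))] with t hmem
    exact (chartMetric_coframe hmem _ _).symm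
  refine (hD.congr_of_eventuallyEq hev (hev.self_of_nhdsWithin ht)).congr_deriv ?_
  -- At the centre of the chart coordinates are the vectors themselves. The derivative of the metric
  -- is the sum of two Christoffel terms, which the two parallel equations cancel.
  simp only [chartMetric_self, coframe_self]
  have h1 := hv0 (W t₀)
  have h2 := hw0 (V t₀)
  have h3 := christoffel_add_swap (γ t₀) c' (V t₀) (W t₀)
  rw [tip_comm (γ t₀) (V t₀) w']
  linarith

theorem tip_eq_of_isParallelAlong {γ : ℝ → M} (hγ : ContinuousOn γ (Icc 0 1))
    {V W : ℝ → E} (hV : IsParallelAlong (E := E) γ V) (hW : IsParallelAlong (E := E) γ W)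
    {t : ℝ} (ht : t ∈ Icc (0 : ℝ) 1) :
    tip (γ t) (V t) (W t) = tip (γ 0) (V 0) (W 0) := by
  have h := fun t₀ ht => hasDerivWithinAt_tip_of_isParallelAlong hγ hV hW (t₀ := t₀) ht
  refine constant_of_derivWithin_zero (f := fun t => tip (γ t) (V t) (W t))
    (fun t ht => (h t ht).differentiableWithinAt) (fun t ht => ?_) t ht
  have ht' : t ∈ Icc (0 : ℝ) 1 := ⟨ht.1, ht.2.le⟩
  exact (h t ht').derivWithin (uniqueDiffOn_Icc zero_lt_one t ht')

end Parallel

/-! ### Isometries from equal Gram matrices -/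

section Gram

/-- Two families of vectors with the same Gram matrix are related by an isometry. -/
theorem exists_linearIsometryEquiv_of_inner_eq {ι F G : Type*}
    [NormedAddCommGroup F] [InnerProductSpace ℝ F] [FiniteDimensional ℝ F]
    [NormedAddCommGroup G] [InnerProductSpace ℝ G] [FiniteDimensional ℝ G]
    (hd : Module.finrank ℝ F = Module.finrank ℝ G) (a : ι → F) (b : ι → G)
    (h : ∀ i j, inner ℝ (a i) (a j) = inner ℝ (b i) (b j)) :
    ∃ A : F ≃ₗᵢ[ℝ] G, ∀ i, A (a i) = b i := by
  let f := Finsupp.linearCombination ℝ a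
  let g := Finsupp.linearCombination ℝ b
  have hn : ∀ x, ‖g x‖ = ‖f x‖ := by
    intro x
    have : inner ℝ (g x) (g x) = inner ℝ (f x) (f x) := by
      simp only [f, g, Finsupp.linearCombination_apply, Finsupp.sum, sum_inner, inner_sum,
        inner_smul_left, inner_smul_right, h]
    rw [real_inner_self_eq_norm_sq, real_inner_self_eq_norm_sq] at this
    exact (sq_eq_sq₀ (norm_nonneg _) (norm_nonneg _)).1 this
  obtain ⟨r, hr⟩ := f.rangeRestrict.exists_rightInverse_of_surjective
    (LinearMap.range_rangeRestrict f)
  have hfr : ∀ y : LinearMap.range f, f (r y) = y := fun y =>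
    congrArg Subtype.val (LinearMap.congr_fun hr y)
  -- `LinearIsometry.extend` extends an isometry from a subspace into the same ambient space, so the
  -- partial isometry `g ∘ r` is first moved into `F` by an auxiliary `J`, which is undone at the
  -- end.
  let J : F ≃ₗᵢ[ℝ] G := (stdOrthonormalBasis ℝ F).equiv (stdOrthonormalBasis ℝ G) (finCongr hd)
  let l : LinearMap.range f →ₗᵢ[ℝ] F :=
    J.symm.toLinearIsometry.comp
      { toLinearMap := g ∘ₗ r
        norm_map' := fun y => by
          change ‖g (r y)‖ = ‖y‖
          rw [hn, hfr]
          rfl }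
  let e : F ≃ₗᵢ[ℝ] F := l.extend.toLinearIsometryEquiv rfl
  refine ⟨e.trans J, fun i => ?_⟩
  have hfi : f (Finsupp.single i 1) = a i := by simp [f]
  have hgi : g (Finsupp.single i 1) = b i := by simp [g]
  let y : LinearMap.range f := ⟨f (Finsupp.single i 1), LinearMap.mem_range_self _ _⟩
  have h1 : e (a i) = J.symm (g (r y)) := by
    have := l.extend_apply y
    rw [← hfi]
    exact this
  -- The section `r` was arbitrary: two preimages under `f` differ by an element of ker `f`, and
  -- `hn` puts it in ker `g`.
  have h2 : g (r y) = g (Finsupp.single i 1) := by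
    rw [← sub_eq_zero, ← map_sub, ← norm_eq_zero, hn, map_sub, hfr]
    simp [y]
  change J (e (a i)) = b i
  rw [h1, h2, hgi, J.apply_symm_apply]

end Gram

/-! ### Velocities and reparametrization of geodesics -/

section Velocity

variable {E : Type*} [NormedAddCommGroup E] [NormedSpace ℝ E]
  {M : Type*} [MetricSpace M] [ChartedSpace E M]

/-- The velocity of a curve, as a vector of the model space. -/
def vel (γ : ℝ → M) (t : ℝ) : E := velocity (E := E) γ t

theorem vel_congr {γ γ' : ℝ → M} (h : EqOn γ' γ (Icc 0 1)) {t : ℝ} (ht : t ∈ Icc (0 : ℝ) 1) :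
    (vel γ' t : E) = vel γ t := by
  have := mfderivWithin_congr (I := 𝓘(ℝ, ℝ)) (I' := 𝓘(ℝ, E)) h (h ht)
  exact congrArg (fun l : ℝ →L[ℝ] E => l 1) this

theorem hasMFDerivWithinAt_vel {γ : ℝ → M} {t : ℝ}
    (h : MDifferentiableWithinAt 𝓘(ℝ, ℝ) 𝓘(ℝ, E) γ (Icc 0 1) t) :
    HasMFDerivWithinAt 𝓘(ℝ, ℝ) 𝓘(ℝ, E) γ (Icc 0 1) t
      (ContinuousLinearMap.toSpanSingleton ℝ (vel γ t : E)) := by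
  have : (ContinuousLinearMap.toSpanSingleton ℝ (vel γ t : E) : ℝ →L[ℝ] E)
      = mfderivWithin 𝓘(ℝ, ℝ) 𝓘(ℝ, E) γ (Icc 0 1) t := by
    refine ContinuousLinearMap.ext_ring ?_
    exact ContinuousLinearMap.toSpanSingleton_apply_one ℝ (vel γ t : E)
  have key : ∀ l : ℝ →L[ℝ] E, l = mfderivWithin 𝓘(ℝ, ℝ) 𝓘(ℝ, E) γ (Icc 0 1) t →
      HasMFDerivWithinAt 𝓘(ℝ, ℝ) 𝓘(ℝ, E) γ (Icc 0 1) t l := by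
    rintro _ rfl
    exact h.hasMFDerivWithinAt
  exact key _ this

theorem mul_mem_Icc {t s : ℝ} (ht : t ∈ Icc (0 : ℝ) 1) (hs : s ∈ Icc (0 : ℝ) 1) :
    t * s ∈ Icc (0 : ℝ) 1 :=
  ⟨mul_nonneg ht.1 hs.1, mul_le_one₀ ht.2 hs.1 hs.2⟩

theorem vel_comp_mul {γ : ℝ → M} {t s : ℝ} (ht : t ∈ Icc (0 : ℝ) 1) (hs : s ∈ Icc (0 : ℝ) 1)
    (h : MDifferentiableWithinAt 𝓘(ℝ, ℝ) 𝓘(ℝ, E) γ (Icc 0 1) (t * s)) :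
    (vel (fun r => γ (t * r)) s : E) = t • (vel γ (t * s) : E) := by
  have h1 := hasMFDerivWithinAt_vel h
  have h2 : HasMFDerivWithinAt 𝓘(ℝ, ℝ) 𝓘(ℝ, ℝ) (fun r : ℝ => t * r) (Icc 0 1) s
      (ContinuousLinearMap.toSpanSingleton ℝ t) :=
    (((hasDerivAt_id s).const_mul t).hasDerivWithinAt.congr_deriv
      (mul_one t)).hasFDerivWithinAt.hasMFDerivWithinAt
  have h3 := (HasMFDerivWithinAt.comp s h1 h2 fun r hr => mul_mem_Icc ht hr).mfderivWithin
    ((uniqueDiffOn_Icc zero_lt_one s hs).uniqueMDiffWithinAt)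
  refine (congrArg (fun l : ℝ →L[ℝ] E => l 1) h3).trans ?_
  change (ContinuousLinearMap.toSpanSingleton ℝ (vel γ (t * s) : E))
    (ContinuousLinearMap.toSpanSingleton ℝ t (1 : ℝ)) = _
  simp [ContinuousLinearMap.toSpanSingleton_apply]

variable [IsManifold 𝓘(ℝ, E) ∞ M] [RiemannianBundle (fun x : M => TangentSpace 𝓘(ℝ, E) x)]

theorem christoffel_smul (p : M) (a b : ℝ) (u v w : E) :
    christoffel (E := E) p (a • u) (b • v) w = a * b * christoffel (E := E) p u v w := by
  have h1 : (fun e => chartMetric p e (b • v) w) = b • fun e => chartMetric p e v w :=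
    funext fun e => chartMetric_smul_left p e b v w
  have h2 : (fun e => chartMetric p e (a • u) w) = a • fun e => chartMetric p e u w :=
    funext fun e => chartMetric_smul_left p e a u w
  have h3 : (fun e => chartMetric p e (a • u) (b • v)) = (a * b) • fun e => chartMetric p e u v :=
    funext fun e => by
      simp only [chartMetric_smul_left, chartMetric_smul_right, Pi.smul_apply, smul_eq_mul]
      ring
  unfold christoffel
  simp only [h1, h2, h3, fderiv_const_smul_field, map_smul, Pi.smul_apply,
    FunLike.coe_smul, smul_eq_mul]
  ring

theorem IsGeodesic.mdifferentiableOn {γ : ℝ → M} (h : IsGeodesic E γ) :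
    MDifferentiableOn 𝓘(ℝ, ℝ) 𝓘(ℝ, E) γ (Icc 0 1) :=
  h.1.mdifferentiableOn (by simp)

theorem IsGeodesic.continuousOn {γ : ℝ → M} (h : IsGeodesic E γ) : ContinuousOn γ (Icc 0 1) :=
  h.1.continuousOn

theorem IsGeodesic.isParallelAlong_vel {γ : ℝ → M} (h : IsGeodesic E γ) :
    IsParallelAlong (E := E) γ (vel γ : ℝ → E) := h.2

theorem IsMinGeodesic.tnorm_vel_zero {X : Set M} {x y : M} {γ : ℝ → M}
    (h : IsMinGeodesic E X x y γ) : tnorm (γ 0) (vel γ 0 : E) = dist x y := h.length_eq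

/-- The restriction of a geodesic to `[0, t]`, reparametrized, is a geodesic. -/
theorem IsGeodesic.comp_mul {γ : ℝ → M} (h : IsGeodesic E γ) {t : ℝ} (ht : t ∈ Icc (0 : ℝ) 1) :
    IsGeodesic E (fun s => γ (t * s)) := by
  have hmaps : MapsTo (fun s : ℝ => t * s) (Icc 0 1) (Icc 0 1) := fun s hs => mul_mem_Icc ht hs
  refine ⟨h.1.comp ?_ hmaps, ?_⟩
  · exact (contDiff_const.mul contDiff_id).contMDiff.contMDiffOn
  · refine (isParallelAlong_iff (E := E) (fun s => γ (t * s)) (vel fun s => γ (t * s))).2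
      fun s₀ hs₀ => ?_
    obtain ⟨c', v', hc, hv, h0⟩ := (isParallelAlong_iff (E := E) γ (vel γ)).1
      h.isParallelAlong_vel (t * s₀) (hmaps hs₀)
    have hm : HasDerivWithinAt (fun s : ℝ => t * s) t (Icc 0 1) s₀ :=
      ((hasDerivAt_id s₀).const_mul t).hasDerivWithinAt.congr_deriv (mul_one t)
    -- One factor `t` comes from rescaling the velocity, the other from the chain rule; the
    -- Christoffel term is quadratic in the velocity and scales by the same t².
    refine ⟨t • c', t • t • v', hc.scomp s₀ hm hmaps, ?_, fun w => ?_⟩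
    · refine ((hv.scomp s₀ hm hmaps).const_smul t).congr_of_mem (fun s hs => ?_) hs₀
      simp only [Pi.smul_apply, Function.comp_apply]
      rw [vel_comp_mul ht hs (h.mdifferentiableOn _ (hmaps hs)), map_smul]
    · rw [vel_comp_mul ht hs₀ (h.mdifferentiableOn _ (hmaps hs₀)), christoffel_smul,
        tip_smul_left, tip_smul_left]
      linear_combination t * t * h0 w

end Velocity

/-! ### Geodesics and Riemannian distance -/

section Distance

variable {E : Type*} [NormedAddCommGroup E] [NormedSpace ℝ E] [FiniteDimensional ℝ E]
  {M : Type*} [MetricSpace M] [ChartedSpace E M] [IsManifold 𝓘(ℝ, E) ∞ M]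
  [RiemannianBundle (fun x : M => TangentSpace 𝓘(ℝ, E) x)]
  [IsContMDiffRiemannianBundle 𝓘(ℝ, E) ∞ E (fun x : M => TangentSpace 𝓘(ℝ, E) x)]

theorem IsGeodesic.tnorm_vel {γ : ℝ → M} (h : IsGeodesic E γ) {t : ℝ} (ht : t ∈ Icc (0 : ℝ) 1) :
    tnorm (γ t) (vel γ t : E) = tnorm (γ 0) (vel γ 0 : E) := by
  have := tip_eq_of_isParallelAlong h.continuousOn h.isParallelAlong_vel h.isParallelAlong_vel ht
  rw [tip_self, tip_self] at this
  exact (sq_eq_sq₀ (tnorm_nonneg _ _) (tnorm_nonneg _ _)).1 this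

variable [IsRiemannianManifold 𝓘(ℝ, E) M]

/-- Riemannian distance is at most path length, and constant speed makes the length of this arc
equal to the right-hand side. -/
theorem IsGeodesic.dist_le {γ : ℝ → M} (h : IsGeodesic E γ) {a b : ℝ} (ha : 0 ≤ a) (hab : a ≤ b)
    (hb : b ≤ 1) : dist (γ a) (γ b) ≤ (b - a) * tnorm (γ 0) (vel γ 0 : E) := by
  have hsub : Icc a b ⊆ Icc (0 : ℝ) 1 := Icc_subset_Icc ha hb
  have h1 : edist (γ a) (γ b) ≤ Manifold.pathELength 𝓘(ℝ, E) γ a b := by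
    rw [IsRiemannianManifold.out (I := 𝓘(ℝ, E))]
    exact Manifold.riemannianEDist_le_pathELength ((h.1.of_le (by simp)).mono hsub) rfl rfl hab
  have h2 : Manifold.pathELength 𝓘(ℝ, E) γ a b
      = ENNReal.ofReal ((b - a) * tnorm (γ 0) (vel γ 0 : E)) := by
    rw [Manifold.pathELength_eq_lintegral_mfderiv_Ioo]
    have : ∀ t ∈ Ioo a b, ‖mfderiv 𝓘(ℝ, ℝ) 𝓘(ℝ, E) γ t 1‖ₑ
        = ENNReal.ofReal (tnorm (γ 0) (vel γ 0 : E)) := by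
      intro t ht
      have hmem : Icc (0 : ℝ) 1 ∈ 𝓝 t :=
        Icc_mem_nhds (ha.trans_lt ht.1) (ht.2.trans_le hb)
      rw [← h.tnorm_vel (hsub (Ioo_subset_Icc_self ht)), ← mfderivWithin_of_mem_nhds hmem]
      exact (ofReal_norm (E := TangentSpace 𝓘(ℝ, E) (γ t)) (vel γ t : E)).symm
    rw [setLIntegral_congr_fun measurableSet_Ioo this, setLIntegral_const, Real.volume_Ioo,
      ENNReal.ofReal_mul (sub_nonneg.2 hab), mul_comm]
  rw [h2, edist_dist] at h1
  exact (ENNReal.ofReal_le_ofReal_iff (mul_nonneg (sub_nonneg.2 hab) (tnorm_nonneg _ _))).1 h1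

/-- The arcs before and after time `t` bound the two distances by t·d and (1 - t)·d; the triangle
inequality leaves no slack. -/
theorem IsMinGeodesic.dist_left {X : Set M} {x y : M} {γ : ℝ → M}
    (h : IsMinGeodesic E X x y γ) {t : ℝ} (ht : t ∈ Icc (0 : ℝ) 1) :
    dist x (γ t) = t * dist x y := by
  have h1 := h.geodesic.dist_le le_rfl ht.1 ht.2
  have h2 := h.geodesic.dist_le ht.1 ht.2 le_rfl
  have h3 := dist_triangle (γ 0) (γ t) (γ 1)
  rw [h.tnorm_vel_zero] at h1 h2
  rw [h.left] at h1 h3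
  rw [h.right] at h2 h3
  linarith

theorem IsMinGeodesic.comp_mul {X : Set M} {x y : M} {γ : ℝ → M}
    (h : IsMinGeodesic E X x y γ) {t : ℝ} (ht : t ∈ Icc (0 : ℝ) 1) :
    IsMinGeodesic E X x (γ t) (fun s => γ (t * s)) where
  geodesic := h.geodesic.comp_mul ht
  left := by simp [h.left]
  right := by simp
  mapsTo := fun s hs => h.mapsTo (mul_mem_Icc ht hs)
  length_eq := by
    have h0 : (0 : ℝ) ∈ Icc (0 : ℝ) 1 := ⟨le_rfl, zero_le_one⟩
    change tnorm (γ (t * 0)) (vel (fun s => γ (t * s)) 0 : E) = _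
    rw [vel_comp_mul ht h0 (h.geodesic.mdifferentiableOn _ (mul_mem_Icc ht h0)), tnorm_smul,
      mul_zero, h.tnorm_vel_zero, h.dist_left ht, abs_of_nonneg ht.1]

end Distance

/-! ### Geodesics and parallel transport inside a convex set -/

section Convex

variable {E : Type*} [NormedAddCommGroup E] [NormedSpace ℝ E]
  {M : Type*} [MetricSpace M] [ChartedSpace E M] [IsManifold 𝓘(ℝ, E) ∞ M]
  [RiemannianBundle (fun x : M => TangentSpace 𝓘(ℝ, E) x)]

/-- The inverse exponential map, as a vector of the model space. -/
def texp (X : Set M) (x y : M) : E := expInv (E := E) X x y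

theorem isMinGeodesic_geod {X : Set M} (hX : IsGeodesicallyConvex E X) {x y : M} (hx : x ∈ X)
    (hy : y ∈ X) : IsMinGeodesic E X x y (geod E X x y) := by
  obtain ⟨γ, hγ, -⟩ := hX x hx y hy
  have h : ∃ γ, IsMinGeodesic E X x y γ := ⟨γ, hγ⟩
  rw [geod, dif_pos h]
  exact h.choose_spec

theorem IsMinGeodesic.eqOn_geod {X : Set M} (hX : IsGeodesicallyConvex E X) {x y : M} (hx : x ∈ X)
    (hy : y ∈ X) {γ : ℝ → M} (hγ : IsMinGeodesic E X x y γ) :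
    EqOn (geod E X x y) γ (Icc 0 1) := by
  obtain ⟨γ₀, -, hu⟩ := hX x hx y hy
  exact (hu _ (isMinGeodesic_geod hX hx hy)).trans (hu _ hγ).symm

theorem tnorm_texp {X : Set M} (hX : IsGeodesicallyConvex E X) {x y : M} (hx : x ∈ X)
    (hy : y ∈ X) : tnorm x (texp X x y : E) = dist x y := by
  have h := isMinGeodesic_geod hX hx hy
  have h1 := h.tnorm_vel_zero
  rw [h.left] at h1
  exact h1

/-- Parallel transport, as a map on the model space. -/
def ttransport (X : Set M) (x y : M) (v : E) : E := transport (E := E) X x y v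

variable [FiniteDimensional ℝ E]
  [IsContMDiffRiemannianBundle 𝓘(ℝ, E) ∞ E (fun x : M => TangentSpace 𝓘(ℝ, E) x)]

/-- The families V(0) and V(1), indexed by all parallel fields, have the same Gram matrix. No
existence theory for parallel fields is needed: the later arguments use only an isometry that
respects the velocity field. -/
theorem exists_transportAlong {γ : ℝ → M} (hγ : ContinuousOn γ (Icc 0 1)) :
    ∃ A : TangentSpace 𝓘(ℝ, E) (γ 0) ≃ₗᵢ[ℝ] TangentSpace 𝓘(ℝ, E) (γ 1),
      ∀ V : ∀ t, TangentSpace 𝓘(ℝ, E) (γ t), IsParallelAlong γ V → A (V 0) = V 1 := by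
  have : ∀ x : M, FiniteDimensional ℝ (TangentSpace 𝓘(ℝ, E) x) :=
    fun x => inferInstanceAs (FiniteDimensional ℝ E)
  obtain ⟨A, hA⟩ := exists_linearIsometryEquiv_of_inner_eq
    (ι := {V : ∀ t, TangentSpace 𝓘(ℝ, E) (γ t) // IsParallelAlong γ V})
    (F := TangentSpace 𝓘(ℝ, E) (γ 0)) (G := TangentSpace 𝓘(ℝ, E) (γ 1)) rfl
    (fun V => V.1 0) (fun V => V.1 1)
    (fun V W => (tip_eq_of_isParallelAlong hγ V.2 W.2 ⟨zero_le_one, le_rfl⟩).symm)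
  exact ⟨A, fun V hV => hA ⟨V, hV⟩⟩

/-- Parallel transport between two points of `X` is a linear isometry, and it transports the
velocity of the geodesic. -/
theorem exists_linearMap_ttransport {X : Set M} (hX : IsGeodesicallyConvex E X) {x y : M}
    (hx : x ∈ X) (hy : y ∈ X) :
    ∃ A : E →ₗ[ℝ] E, (∀ v, ttransport X x y v = A v) ∧
      (∀ u v, tip y (A u) (A v) = tip x u v) ∧ A (texp X x y) = vel (geod E X x y) 1 := by
  have h := isMinGeodesic_geod hX hx hy
  have hA := exists_transportAlong (E := E) h.geodesic.continuousOn
  let A : E →ₗ[ℝ] E := hA.choose.toLinearEquiv.toLinearMap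
  refine ⟨A, fun v => ?_, fun u v => ?_,
    hA.choose_spec _ h.geodesic.isParallelAlong_vel⟩
  · unfold ttransport transport transportAlong
    rw [dif_pos hA]
    rfl
  · have h1 : tip (geod E X x y 1) (A u) (A v) = tip (geod E X x y 0) u v :=
      hA.choose.inner_map_map u v
    rw [h.left, h.right] at h1
    exact h1

end Convex

/-! ### Gradients, smoothness and the descent lemma -/

section Gradient

variable {E : Type*} [NormedAddCommGroup E] [NormedSpace ℝ E] [FiniteDimensional ℝ E]
  {M : Type*} [MetricSpace M] [ChartedSpace E M]
  [RiemannianBundle (fun x : M => TangentSpace 𝓘(ℝ, E) x)]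

/-- The gradient, as a vector of the model space. -/
def tgrad (φ : M → ℝ) (x : M) : E := grad (E := E) φ x

theorem tip_tgrad (φ : M → ℝ) (x : M) (w : E) :
    tip x (tgrad φ x) w = (mfderiv 𝓘(ℝ, E) 𝓘(ℝ, ℝ) φ x : E →L[ℝ] ℝ) w := by
  have : FiniteDimensional ℝ (TangentSpace 𝓘(ℝ, E) x) := inferInstanceAs (FiniteDimensional ℝ E)
  have : CompleteSpace (TangentSpace 𝓘(ℝ, E) x) := FiniteDimensional.complete ℝ _
  exact InnerProductSpace.toDual_symm_apply (𝕜 := ℝ) (E := TangentSpace 𝓘(ℝ, E) x)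

theorem mdifferentiableAt_objective {m : ℕ} {φ : Fin m → M → ℝ} {x : M}
    (h : ∀ i, MDifferentiableAt 𝓘(ℝ, E) 𝓘(ℝ, ℝ) (φ i) x) :
    MDifferentiableAt 𝓘(ℝ, E) 𝓘(ℝ, ℝ) (objective φ) x ∧
      (tgrad (objective φ) x : E) = (1 / m : ℝ) • ∑ i, (tgrad (φ i) x : E) := by
  have hs := (HasMFDerivAt.sum (t := Finset.univ) fun i _ => (h i).hasMFDerivAt).const_smul
    (1 / m : ℝ)
  have he : objective φ = (1 / m : ℝ) • ∑ i, φ i := by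
    funext y
    simp [objective]
  rw [← he] at hs
  refine ⟨hs.mdifferentiableAt, tip_left_injective x fun w => ?_⟩
  rw [tip_tgrad, tip_smul_left, tip_sum_left]
  simp only [tip_tgrad]
  have h2 := congrArg (fun l : E →L[ℝ] ℝ => l w) hs.mfderiv
  refine h2.trans ?_
  let l : Fin m → E →L[ℝ] ℝ := fun i => mfderiv 𝓘(ℝ, E) 𝓘(ℝ, ℝ) (φ i) x
  change ((1 / m : ℝ) • ∑ i, l i) w = (1 / m : ℝ) * ∑ i, l i w
  simp

variable [IsManifold 𝓘(ℝ, E) ∞ M]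
  [IsContMDiffRiemannianBundle 𝓘(ℝ, E) ∞ E (fun x : M => TangentSpace 𝓘(ℝ, E) x)]

/-- Transport is linear, so the defect of the average is the average of the defects. -/
theorem isLSmoothOn_objective {X : Set M} (hX : IsGeodesicallyConvex E X) {m : ℕ} (hm : 0 < m)
    {φ : Fin m → M → ℝ} {L : ℝ} (h : ∀ i, IsLSmoothOn E L X (φ i)) :
    IsLSmoothOn E L X (objective φ) := by
  have hd := fun x hx => mdifferentiableAt_objective (φ := φ) (x := x) fun i => (h i).1 x hx
  have hm' : (0 : ℝ) < m := Nat.cast_pos.2 hm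
  refine ⟨fun x hx => (hd x hx).1, fun x hx y hy => ?_⟩
  obtain ⟨A, hA, -, -⟩ := exists_linearMap_ttransport hX hx hy
  have hi : ∀ i, tnorm y (tgrad (φ i) y - A (tgrad (φ i) x) : E) ≤ L * dist x y := fun i => by
    rw [← hA]
    exact (h i).2 x hx y hy
  change tnorm y (tgrad (objective φ) y - ttransport X x y (tgrad (objective φ) x) : E) ≤ _
  rw [hA, (hd x hx).2, (hd y hy).2, map_smul, map_sum, ← smul_sub, ← Finset.sum_sub_distrib,
    tnorm_smul, abs_of_nonneg (by positivity)]
  calc (1 / m : ℝ) * tnorm y (∑ i, (tgrad (φ i) y - A (tgrad (φ i) x)) : E)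
      ≤ (1 / m : ℝ) * ∑ i : Fin m, L * dist x y := by
        gcongr
        exact (tnorm_sum_le _ _ _).trans (Finset.sum_le_sum fun i _ => hi i)
    _ = L * dist x y := by
        rw [Finset.sum_const, Finset.card_univ, Fintype.card_fin, nsmul_eq_mul]
        field_simp

variable [IsRiemannianManifold 𝓘(ℝ, E) M]

/-- Along the geodesic `γ` from `x` to `z`, the derivative of an `L`-smooth function grows at most
linearly. -/
theorem IsLSmoothOn.tip_vel_le {X : Set M} (hX : IsGeodesicallyConvex E X) {L : ℝ} {φ : M → ℝ}
    (h : IsLSmoothOn E L X φ) {x z : M} (hx : x ∈ X) (hz : z ∈ X) {t : ℝ}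
    (ht : t ∈ Icc (0 : ℝ) 1) :
    tip (geod E X x z t) (tgrad φ (geod E X x z t)) (vel (geod E X x z) t : E)
      ≤ tip x (tgrad φ x) (texp X x z : E) + L * dist x z ^ 2 * t := by
  have hγ := isMinGeodesic_geod hX hx hz
  have hv0 : (texp X x z : E) = vel (geod E X x z) 0 := rfl
  rcases ht.1.eq_or_lt with rfl | htpos
  · rw [hv0, hγ.left]
    simp
  set γ := geod E X x z with hγdef
  have hy : γ t ∈ X := hγ.mapsTo ht
  have h0 : (0 : ℝ) ∈ Icc (0 : ℝ) 1 := ⟨le_rfl, zero_le_one⟩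
  have h1 : (1 : ℝ) ∈ Icc (0 : ℝ) 1 := ⟨zero_le_one, le_rfl⟩
  -- Smoothness between `x` and `γ t` refers to the chosen geodesic joining them. By uniqueness this
  -- is the rescaled initial arc of `γ`, so its transport `A` carries `t • vel γ 0` to `t • vel γ
  -- t`; dividing by `t` needs the case t = 0 set aside.
  have heq := (hγ.comp_mul ht).eqOn_geod hX hx hy
  obtain ⟨A, hA, hiso, hvel⟩ := exists_linearMap_ttransport hX hx hy
  have e0 : (texp X x (γ t) : E) = t • vel γ 0 := by
    change vel (geod E X x (γ t)) 0 = _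
    rw [vel_congr heq h0, vel_comp_mul ht h0 (hγ.geodesic.mdifferentiableOn _ (mul_mem_Icc ht h0)),
      mul_zero]
  have e1 : (vel (geod E X x (γ t)) 1 : E) = t • vel γ t := by
    rw [vel_congr heq h1, vel_comp_mul ht h1 (hγ.geodesic.mdifferentiableOn _ (mul_mem_Icc ht h1)),
      mul_one]
  have hAv : A (vel γ 0) = vel γ t := by
    rw [e0, e1, map_smul] at hvel
    exact smul_right_injective E htpos.ne' hvel
  have hb : tnorm (γ t) (tgrad φ (γ t) - A (tgrad φ x) : E) ≤ L * dist x (γ t) := by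
    rw [← hA]
    exact h.2 x hx _ hy
  have hn : tnorm (γ t) (vel γ t : E) = dist x z := by
    rw [hγ.geodesic.tnorm_vel ht, hγ.tnorm_vel_zero]
  rw [hγ.dist_left ht] at hb
  have hs : tip (γ t) (tgrad φ (γ t) - A (tgrad φ x) : E) (vel γ t)
      ≤ L * (t * dist x z) * dist x z := by
    refine (tip_le _ _ _).trans ?_
    rw [hn]
    gcongr
  have hi : tip (γ t) (A (tgrad φ x)) (vel γ t : E) = tip x (tgrad φ x) (texp X x z : E) := by
    rw [← hAv, hiso, hv0]
  rw [tip_sub_left, hi] at hs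
  linarith

/-- The descent lemma along a geodesic of `X`. -/
theorem IsLSmoothOn.descent {X : Set M} (hX : IsGeodesicallyConvex E X) {L : ℝ} {φ : M → ℝ}
    (h : IsLSmoothOn E L X φ) {x z : M} (hx : x ∈ X) (hz : z ∈ X) {t : ℝ}
    (ht : t ∈ Icc (0 : ℝ) 1) :
    φ (geod E X x z t) ≤ φ x + t * tip x (tgrad φ x) (texp X x z : E)
      + L * dist x z ^ 2 * t ^ 2 / 2 := by
  have hγ := isMinGeodesic_geod hX hx hz
  have hd : ∀ s ∈ Icc (0 : ℝ) 1, HasDerivWithinAt (fun s => φ (geod E X x z s))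
      (tip (geod E X x z s) (tgrad φ (geod E X x z s)) (vel (geod E X x z) s : E)) (Icc 0 1) s := by
    intro s hs
    have h1 := hasMFDerivWithinAt_vel (hγ.geodesic.mdifferentiableOn s hs)
    have h2 := (h.1 _ (hγ.mapsTo hs)).hasMFDerivAt
    let l : E →L[ℝ] ℝ := mfderiv 𝓘(ℝ, E) 𝓘(ℝ, ℝ) φ (geod E X x z s)
    have h3 : HasFDerivWithinAt (fun s => φ (geod E X x z s))
        (l.comp (ContinuousLinearMap.toSpanSingleton ℝ (vel (geod E X x z) s : E))) (Icc 0 1) s :=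
      (h2.comp_hasMFDerivWithinAt s h1).hasFDerivWithinAt
    refine h3.hasDerivWithinAt.congr_deriv ?_
    rw [tip_tgrad]
    change l (ContinuousLinearMap.toSpanSingleton ℝ (vel (geod E X x z) s : E) 1) = _
    rw [ContinuousLinearMap.toSpanSingleton_apply_one]
    rfl
  have hq : ∀ s : ℝ, HasDerivAt (fun s => s * tip x (tgrad φ x) (texp X x z : E)
      + L * dist x z ^ 2 * s ^ 2 / 2)
      (tip x (tgrad φ x) (texp X x z : E) + L * dist x z ^ 2 * s) s := by
    intro s
    refine (((hasDerivAt_id s).mul_const _).add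
      ((((hasDerivAt_pow 2 s).const_mul (L * dist x z ^ 2))).div_const 2)).congr_deriv ?_
    simp
    ring
  -- The derivative of φ along the geodesic is dominated by that of the comparison quadratic, so
  -- their difference decreases from its value at time 0.
  have hanti := antitoneOn_of_hasDerivWithinAt_nonpos (convex_Icc (0 : ℝ) 1)
    (f := fun s => φ (geod E X x z s) - (s * tip x (tgrad φ x) (texp X x z : E)
      + L * dist x z ^ 2 * s ^ 2 / 2))
    (fun s hs => ((hd s hs).sub (hq s).hasDerivWithinAt).continuousWithinAt)
    (fun s hs => ((hd s (interior_subset hs)).sub (hq s).hasDerivWithinAt).mono interior_subset)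
    (fun s hs => sub_nonpos.2 (h.tip_vel_le hX hx hz (interior_subset hs)))
  have := hanti ⟨le_rfl, zero_le_one⟩ ht ht.1
  simp only [hγ.left] at this
  linarith

end Gradient

/-! ### Minibatch averages over a finite index set -/

section Averages

/-- Swapping the fresh value with the old entry at `i` is an involution on pairs (u, c). This is the
finite form of conditioning on all coordinates but one. -/
theorem sum_sum_update {ι κ R : Type*} [Fintype ι] [DecidableEq ι] [Fintype κ] [AddCommMonoid R]
    (i : ι) (f : (ι → κ) → R) :
    ∑ u : ι → κ, ∑ c : κ, f (Function.update u i c) = Fintype.card κ • ∑ u : ι → κ, f u := by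
  let e : (ι → κ) × κ ≃ (ι → κ) × κ := Function.Involutive.toPerm
    (fun q => (Function.update q.1 i q.2, q.1 i)) (fun q => by simp)
  calc ∑ u : ι → κ, ∑ c : κ, f (Function.update u i c)
      = ∑ q : (ι → κ) × κ, f (e q).1 := (Fintype.sum_prod_type' _).symm
    _ = ∑ q : (ι → κ) × κ, f q.1 := e.sum_comp fun q => f q.1
    _ = ∑ u : ι → κ, ∑ _c : κ, f u := Fintype.sum_prod_type' fun u (_ : κ) => f u
    _ = Fintype.card κ • ∑ u : ι → κ, f u := by
        simp [Finset.card_univ, Finset.smul_sum]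

variable {F : Type*} [NormedAddCommGroup F] [InnerProductSpace ℝ F] {m b : ℕ}

theorem sum_inner_minibatch_eq_zero (hm : 0 < m) {a : Fin m → F} (ha : ∑ i, a i = 0) (w : F) :
    ∑ β : Fin b → Fin m, inner ℝ ((1 / b : ℝ) • ∑ j, a (β j)) w = 0 := by
  have h1 : ∀ j : Fin b, ∑ β : Fin b → Fin m, a (β j) = 0 := by
    intro j
    have h := sum_sum_update j (fun β : Fin b → Fin m => a (β j))
    simp only [Function.update_self, ha, Finset.sum_const_zero, Fintype.card_fin] at h
    rw [← Nat.cast_smul_eq_nsmul ℝ] at h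
    exact (smul_eq_zero.1 h.symm).resolve_left (Nat.cast_ne_zero.2 hm.ne')
  rw [← sum_inner, ← Finset.smul_sum, Finset.sum_comm]
  simp [h1]

/-- Independent centred draws are orthogonal on average, so only the `b` diagonal terms survive. The
factor `m` on the left avoids the exponent b - 1. -/
theorem sum_norm_sq_minibatch (hm : 0 < m) {a : Fin m → F} (ha : ∑ i, a i = 0) :
    m * ∑ β : Fin b → Fin m, ‖∑ j, a (β j)‖ ^ 2 = b * (m : ℝ) ^ b * ∑ i, ‖a i‖ ^ 2 := by
  have hmR : (m : ℝ) ≠ 0 := Nat.cast_ne_zero.2 hm.ne'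
  have hoff : ∀ j l : Fin b, j ≠ l → ∑ β : Fin b → Fin m, inner ℝ (a (β j)) (a (β l)) = 0 := by
    intro j l hjl
    have h := sum_sum_update j (fun β : Fin b → Fin m => inner ℝ (a (β j)) (a (β l)))
    simp only [Function.update_self, Function.update_of_ne hjl.symm, ← sum_inner, ha,
      inner_zero_left, Finset.sum_const_zero, Fintype.card_fin] at h
    exact (smul_eq_zero.1 h.symm).resolve_left hm.ne'
  have hdiag : ∀ j : Fin b, m * ∑ β : Fin b → Fin m, inner ℝ (a (β j)) (a (β j))
      = (m : ℝ) ^ b * ∑ i, ‖a i‖ ^ 2 := by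
    intro j
    have h := sum_sum_update j (fun β : Fin b → Fin m => inner ℝ (a (β j)) (a (β j)))
    simp only [Function.update_self, Fintype.card_fin, nsmul_eq_mul, Finset.sum_const,
      Finset.card_univ, Fintype.card_fun, real_inner_self_eq_norm_sq, Nat.cast_pow] at h ⊢
    exact h.symm
  have hexp : ∑ β : Fin b → Fin m, ‖∑ j, a (β j)‖ ^ 2
      = ∑ j : Fin b, ∑ β : Fin b → Fin m, inner ℝ (a (β j)) (a (β j)) := by
    simp only [← real_inner_self_eq_norm_sq (∑ j, a _), sum_inner, inner_sum]
    rw [Finset.sum_comm]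
    refine Finset.sum_congr rfl fun j _ => ?_
    rw [Finset.sum_comm]
    exact Finset.sum_eq_single j (fun l _ hl => hoff l j hl) (by simp)
  rw [hexp, Finset.mul_sum]
  simp only [hdiag]
  simp
  ring

theorem sum_norm_sq_sub_mean_le (hm : 0 < m) (h : Fin m → F) {r : ℝ} (hr : ∀ i, ‖h i‖ ≤ r) :
    ∑ i, ‖h i - (1 / m : ℝ) • ∑ l, h l‖ ^ 2 ≤ m * r ^ 2 := by
  have hmR : (m : ℝ) ≠ 0 := Nat.cast_ne_zero.2 hm.ne'
  set c := (1 / m : ℝ) • ∑ l, h l with hc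
  have hsum : ∑ l, h l = (m : ℝ) • c := by
    rw [hc, smul_smul, mul_one_div_cancel hmR, one_smul]
  have h1 : ∑ i, ‖h i - c‖ ^ 2 = ∑ i, ‖h i‖ ^ 2 - m * ‖c‖ ^ 2 := by
    -- Variance is the second moment minus the squared mean, hence at most the second moment.
    simp only [norm_sub_sq_real, Finset.sum_add_distrib, Finset.sum_sub_distrib,
      ← Finset.mul_sum, ← sum_inner, hsum, real_inner_smul_left, real_inner_self_eq_norm_sq]
    simp
    ring
  have h2 : ∑ i, ‖h i‖ ^ 2 ≤ ∑ _i : Fin m, r ^ 2 :=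
    Finset.sum_le_sum fun i _ => pow_le_pow_left₀ (norm_nonneg _) (hr i) 2
  simp only [Finset.sum_const, Finset.card_univ, Fintype.card_fin, nsmul_eq_mul] at h2
  linarith [mul_nonneg (Nat.cast_nonneg (α := ℝ) m) (sq_nonneg ‖c‖)]

/-- The mean deviation of a minibatch average of bounded vectors from their mean. -/
theorem sum_norm_minibatch_le (hm : 0 < m) (hb : 0 < b) (h : Fin m → F) {r : ℝ}
    (hr : ∀ i, ‖h i‖ ≤ r) :
    ∑ β : Fin b → Fin m, ‖(1 / b : ℝ) • ∑ j, (h (β j) - (1 / m : ℝ) • ∑ l, h l)‖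
      ≤ (m : ℝ) ^ b * (r / Real.sqrt b) := by
  have hmR : (0 : ℝ) < m := Nat.cast_pos.2 hm
  have hbR : (0 : ℝ) < b := Nat.cast_pos.2 hb
  have hr0 : 0 ≤ r := (norm_nonneg _).trans (hr ⟨0, hm⟩)
  have hsum0 : ∑ i, (h i - (1 / m : ℝ) • ∑ l, h l) = 0 := by
    rw [Finset.sum_sub_distrib, Finset.sum_const, Finset.card_univ, Fintype.card_fin,
      ← Nat.cast_smul_eq_nsmul ℝ, smul_smul, mul_one_div_cancel hmR.ne', one_smul, sub_self]
  have h1 := sum_norm_sq_minibatch (b := b) hm hsum0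
  have h2 := sum_norm_sq_sub_mean_le hm h hr
  set T := ∑ β : Fin b → Fin m, ‖∑ j, (h (β j) - (1 / m : ℝ) • ∑ l, h l)‖ ^ 2
  have h3 : T ≤ b * (m : ℝ) ^ b * r ^ 2 := by
    refine le_of_mul_le_mul_left ?_ hmR
    rw [h1]
    calc b * (m : ℝ) ^ b * ∑ i, ‖h i - (1 / m : ℝ) • ∑ l, h l‖ ^ 2
        ≤ b * (m : ℝ) ^ b * (m * r ^ 2) := by gcongr
      _ = m * (b * (m : ℝ) ^ b * r ^ 2) := by ring
  -- Cauchy-Schwarz over the m^b minibatches passes from the second moment to the first; the factor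
  -- 1/b then turns √b into 1/√b.
  have h4 : (∑ β : Fin b → Fin m, ‖∑ j, (h (β j) - (1 / m : ℝ) • ∑ l, h l)‖) ^ 2
      ≤ ((m : ℝ) ^ b * (Real.sqrt b * r)) ^ 2 := by
    refine (sq_sum_le_card_mul_sum_sq (s := Finset.univ)).trans ?_
    rw [Finset.card_univ, Fintype.card_fun, Fintype.card_fin, Fintype.card_fin, Nat.cast_pow]
    calc (m : ℝ) ^ b * T ≤ (m : ℝ) ^ b * (b * (m : ℝ) ^ b * r ^ 2) := by gcongr
      _ = ((m : ℝ) ^ b * (Real.sqrt b * r)) ^ 2 := by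
        rw [mul_pow, mul_pow, Real.sq_sqrt hbR.le]
        ring
  have h5 := abs_le_of_sq_le_sq h4 (by positivity)
  have h6 := (abs_le.1 h5).2
  simp only [norm_smul, ← Finset.mul_sum]
  calc ‖(1 / b : ℝ)‖ * ∑ β : Fin b → Fin m, ‖∑ j, (h (β j) - (1 / m : ℝ) • ∑ l, h l)‖
      ≤ (1 / b) * ((m : ℝ) ^ b * (Real.sqrt b * r)) := by
        rw [Real.norm_of_nonneg (by positivity)]
        gcongr
    _ = (m : ℝ) ^ b * (r / Real.sqrt b) := by
        have hs : Real.sqrt b ≠ 0 := (Real.sqrt_pos.2 hbR).ne'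
        have hs2 : Real.sqrt b * Real.sqrt b = b := Real.mul_self_sqrt hbR.le
        field_simp
        rw [sq, hs2]

end Averages

/-! ### One Frank-Wolfe step with a variance-reduced gradient -/

section Step

variable {E : Type*} [NormedAddCommGroup E] [NormedSpace ℝ E]
  {M : Type*} [MetricSpace M] [ChartedSpace E M] [IsManifold 𝓘(ℝ, E) ∞ M]
  [RiemannianBundle (fun x : M => TangentSpace 𝓘(ℝ, E) x)]
  {X : Set M} {rlo : ∀ x : M, TangentSpace 𝓘(ℝ, E) x → M}

theorem IsRLO.mem (h : IsRLO X rlo) {x : M} (hx : x ∈ X) (g : E) : rlo x g ∈ X := (h x hx g).1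

theorem IsRLO.tip_le (h : IsRLO X rlo) {x : M} (hx : x ∈ X) (g : E) {z : M} (hz : z ∈ X) :
    tip x g (texp X x (rlo x g) : E) ≤ tip x g (texp X x z : E) := (h x hx g).2 z hz

variable [FiniteDimensional ℝ E]

theorem fwGap_le (h : IsRLO X rlo) (Φ : M → ℝ) {x : M} (hx : x ∈ X) :
    fwGap E X Φ x ≤ -tip x (tgrad Φ x) (texp X x (rlo x (tgrad Φ x : E)) : E) := by
  refine csSup_le (Set.Nonempty.image _ ⟨x, hx⟩) ?_
  rintro _ ⟨y, hy, rfl⟩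
  have h1 := h.tip_le hx (tgrad Φ x) hy
  change tip x (texp X x y : E) (-tgrad Φ x) ≤ _
  rw [tip_neg_right, tip_comm]
  linarith

/-- The variance-reduced gradient, as a vector of the model space. -/
def tvrGrad {m : ℕ} (X : Set M) (φ : Fin m → M → ℝ) (xs x : M) (b : ℕ) (i : ℕ → Fin m) : E :=
  vrGrad (E := E) X φ xs x b i

variable [IsContMDiffRiemannianBundle 𝓘(ℝ, E) ∞ E (fun x : M => TangentSpace 𝓘(ℝ, E) x)]

/-- By linearity of transport, the error of the estimator is a centred minibatch average of the
differences grad φᵢ(x) - Γ grad φᵢ(xs), each of norm at most L·d(xs, x). Both its mean and its size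
follow from this form. -/
theorem tvrGrad_sub (hX : IsGeodesicallyConvex E X) {m b : ℕ} (hb : 0 < b)
    {φ : Fin m → M → ℝ} {L : ℝ} (hφ : ∀ i, IsLSmoothOn E L X (φ i)) {xs x : M} (hxs : xs ∈ X)
    (hx : x ∈ X) (i : ℕ → Fin m) :
    (tvrGrad X φ xs x b i - tgrad (objective φ) x : E) = (1 / b : ℝ) • ∑ j : Fin b,
      ((tgrad (φ (i j)) x - ttransport X xs x (tgrad (φ (i j)) xs) : E)
        - (1 / m : ℝ) • ∑ l, (tgrad (φ l) x - ttransport X xs x (tgrad (φ l) xs) : E)) := by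
  obtain ⟨A, hA, -, -⟩ := exists_linearMap_ttransport hX hxs hx
  have hbR : (b : ℝ) ≠ 0 := Nat.cast_ne_zero.2 hb.ne'
  have h1 : (tvrGrad X φ xs x b i : E) = (1 / b : ℝ) • ∑ j ∈ Finset.range b,
      (tgrad (φ (i j)) x
        - ttransport X xs x (tgrad (φ (i j)) xs - tgrad (objective φ) xs) : E) := rfl
  have hg := fun x hx => (mdifferentiableAt_objective (φ := φ) (x := x) fun i => (hφ i).1 x hx).2
  have h2 : ∑ j : Fin b, (tgrad (objective φ) x : E) = (b : ℝ) • (tgrad (objective φ) x : E) := by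
    rw [Finset.sum_const, Finset.card_univ, Fintype.card_fin, Nat.cast_smul_eq_nsmul]
  have h3 : (tgrad (objective φ) x : E) = (1 / b : ℝ) • ∑ j : Fin b, tgrad (objective φ) x := by
    rw [h2, smul_smul, one_div_mul_cancel hbR, one_smul]
  rw [h1, Finset.sum_range]
  conv_lhs => rw [h3]
  rw [← smul_sub, ← Finset.sum_sub_distrib]
  refine congrArg _ (Finset.sum_congr rfl fun j _ => ?_)
  simp only [hA]
  rw [map_sub, hg x hx, hg xs hxs, Finset.sum_sub_distrib, smul_sub, map_smul, map_sum]
  abel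

theorem sum_tip_tvrGrad_sub (hX : IsGeodesicallyConvex E X) {m b : ℕ} (hm : 0 < m) (hb : 0 < b)
    {φ : Fin m → M → ℝ} {L : ℝ} (hφ : ∀ i, IsLSmoothOn E L X (φ i)) {xs x : M} (hxs : xs ∈ X)
    (hx : x ∈ X) {I : (Fin b → Fin m) → ℕ → Fin m} (hI : ∀ β (j : Fin b), I β j = β j) (w : E) :
    ∑ β, tip x (tvrGrad X φ xs x b (I β) - tgrad (objective φ) x) w = 0 := by
  simp only [tvrGrad_sub hX hb hφ hxs hx, hI]
  refine sum_inner_minibatch_eq_zero (F := TangentSpace 𝓘(ℝ, E) x) hm (a := fun i =>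
    ((tgrad (φ i) x - ttransport X xs x (tgrad (φ i) xs) : E)
        - (1 / m : ℝ) • ∑ l, (tgrad (φ l) x - ttransport X xs x (tgrad (φ l) xs) : E))) ?_ w
  have hmR : (m : ℝ) ≠ 0 := Nat.cast_ne_zero.2 hm.ne'
  change ∑ i, ((tgrad (φ i) x - ttransport X xs x (tgrad (φ i) xs) : E)
        - (1 / m : ℝ) • ∑ l, (tgrad (φ l) x - ttransport X xs x (tgrad (φ l) xs) : E)) = 0
  rw [Finset.sum_sub_distrib, Finset.sum_const, Finset.card_univ, Fintype.card_fin,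
      ← Nat.cast_smul_eq_nsmul ℝ, smul_smul, mul_one_div_cancel hmR, one_smul, sub_self]

theorem sum_tnorm_tvrGrad_sub_le (hX : IsGeodesicallyConvex E X) {m b : ℕ} (hm : 0 < m)
    (hb : 0 < b) {φ : Fin m → M → ℝ} {L : ℝ} (hφ : ∀ i, IsLSmoothOn E L X (φ i)) {xs x : M}
    (hxs : xs ∈ X) (hx : x ∈ X) {I : (Fin b → Fin m) → ℕ → Fin m}
    (hI : ∀ β (j : Fin b), I β j = β j) :
    ∑ β, tnorm x (tvrGrad X φ xs x b (I β) - tgrad (objective φ) x : E)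
      ≤ (m : ℝ) ^ b * (L * dist xs x / Real.sqrt b) := by
  simp only [tvrGrad_sub hX hb hφ hxs hx, hI]
  exact sum_norm_minibatch_le (F := TangentSpace 𝓘(ℝ, E) x) hm hb
    (fun i => (tgrad (φ i) x - ttransport X xs x (tgrad (φ i) xs) : E))
    fun i => (hφ i).2 xs hxs x hx

variable [IsRiemannianManifold 𝓘(ℝ, E) M]

/-- The decrease of the objective in one Frank-Wolfe step with an inexact gradient `g`. -/
theorem frankWolfe_step_le (hXc : IsCompact X) (hX : IsGeodesicallyConvex E X)
    (hr : IsRLO X rlo) {L : ℝ} (hL : 0 ≤ L) {Φ : M → ℝ} (hΦ : IsLSmoothOn E L X Φ) {x : M}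
    (hx : x ∈ X) (g : E) {η : ℝ} (hη : η ∈ Icc (0 : ℝ) 1) :
    Φ (geod E X x (rlo x g) η) ≤ Φ x + η * (-fwGap E X Φ x
      + tip x (g - tgrad Φ x) (texp X x (rlo x (tgrad Φ x : E)) : E)
      + tnorm x (g - tgrad Φ x) * Metric.diam X) + L * Metric.diam X ^ 2 * η ^ 2 / 2 := by
  have hz := hr.mem hx g
  -- The comparison point is the oracle's answer for the exact gradient, independent of `g`. Its
  -- error term stays an inner product so that it averages to zero; a norm bound would double the
  -- error and spoil the final constant.
  have hy := hr.mem hx (tgrad Φ x)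
  have h1 := hΦ.descent hX hx hz hη
  have hD : dist x (rlo x g) ≤ Metric.diam X := Metric.dist_le_diam_of_mem hXc.isBounded hx hz
  have h2 : L * dist x (rlo x g) ^ 2 * η ^ 2 / 2 ≤ L * Metric.diam X ^ 2 * η ^ 2 / 2 := by gcongr
  have h3 := fwGap_le hr Φ hx
  have h4 := hr.tip_le hx g hy
  have h5 : tip x (-(g - tgrad Φ x)) (texp X x (rlo x g) : E)
      ≤ tnorm x (g - tgrad Φ x) * Metric.diam X := by
    refine (SvrRfw.tip_le _ _ _).trans ?_
    rw [tnorm_neg, tnorm_texp hX hx hz]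
    exact mul_le_mul_of_nonneg_left hD (tnorm_nonneg _ _)
  have h6 : tip x (tgrad Φ x) (texp X x (rlo x g) : E) ≤ -fwGap E X Φ x
      + tip x (g - tgrad Φ x) (texp X x (rlo x (tgrad Φ x : E)) : E)
      + tnorm x (g - tgrad Φ x) * Metric.diam X := by
    rw [neg_sub, tip_sub_left] at h5
    rw [tip_sub_left]
    linarith
  have h7 := mul_le_mul_of_nonneg_left h6 hη.1
  linarith

/-- The expected decrease of the objective in one step of SVR-RFW. -/
theorem sum_objective_step_le (hXc : IsCompact X) (hX : IsGeodesicallyConvex E X)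
    (hr : IsRLO X rlo) {m b : ℕ} (hm : 0 < m) (hb : 0 < b) {L : ℝ} (hL : 0 ≤ L)
    {φ : Fin m → M → ℝ} (hφ : ∀ i, IsLSmoothOn E L X (φ i)) {xs x : M} (hxs : xs ∈ X) (hx : x ∈ X)
    {I : (Fin b → Fin m) → ℕ → Fin m} (hI : ∀ β (j : Fin b), I β j = β j) {η : ℝ}
    (hη : η ∈ Icc (0 : ℝ) 1) :
    ∑ β, objective φ (geod E X x (rlo x (tvrGrad X φ xs x b (I β) : E)) η)
      ≤ (m : ℝ) ^ b * (objective φ x - η * fwGap E X (objective φ) x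
        + η * (L * dist xs x / Real.sqrt b * Metric.diam X)
        + L * Metric.diam X ^ 2 * η ^ 2 / 2) := by
  have hΦ := isLSmoothOn_objective hX hm hφ
  have h1 := Finset.sum_le_sum fun β (_ : β ∈ Finset.univ) =>
    frankWolfe_step_le hXc hX hr hL hΦ hx (tvrGrad X φ xs x b (I β)) hη
  refine h1.trans ?_
  have h2 := sum_tip_tvrGrad_sub hX hm hb hφ hxs hx hI
    (texp X x (rlo x (tgrad (objective φ) x : E)))
  have h3 := sum_tnorm_tvrGrad_sub_le hX hm hb hφ hxs hx hI
  simp only [Finset.sum_add_distrib, ← Finset.mul_sum, ← Finset.sum_mul, h2, Finset.sum_const,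
    Finset.card_univ, Fintype.card_fun, Fintype.card_fin, nsmul_eq_mul, Nat.cast_pow]
  have h4 := mul_le_mul_of_nonneg_left
    (mul_le_mul_of_nonneg_right h3 (Metric.diam_nonneg (s := X))) hη.1
  linarith

end Step

/-! ### Dependence on the samples, invariance of `X`, and drift from the snapshot -/

section Iterates

variable {E : Type*} [NormedAddCommGroup E] [NormedSpace ℝ E] [FiniteDimensional ℝ E]
  {M : Type*} [MetricSpace M] [ChartedSpace E M] [IsManifold 𝓘(ℝ, E) ∞ M]
  [RiemannianBundle (fun x : M => TangentSpace 𝓘(ℝ, E) x)]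
  {X : Set M} {rlo : ∀ x : M, TangentSpace 𝓘(ℝ, E) x → M} {m : ℕ} {φ : Fin m → M → ℝ}

theorem epoch_congr {η : ℝ} {b : ℕ} {I J : ℕ → ℕ → Fin m} {xs : M} {k : ℕ}
    (h : ∀ k' < k, ∀ j < b, I k' j = J k' j) :
    epoch X φ rlo η b I xs k = epoch X φ rlo η b J xs k := by
  induction k with
  | zero => rfl
  | succ k ih =>
    have ih' := ih fun k' hk' => h k' (hk'.trans k.lt_succ_self)
    have hv : ∀ x : M, vrGrad (E := E) X φ xs x b (I k) = vrGrad X φ xs x b (J k) := fun x => by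
      unfold vrGrad
      refine congrArg _ (Finset.sum_congr rfl fun j hj => ?_)
      rw [h k k.lt_succ_self j (Finset.mem_range.1 hj)]
    simp only [epoch, hv]
    rw [ih']

theorem snapshot_congr {η : ℝ} {b K : ℕ} {I J : ℕ → ℕ → ℕ → Fin m} {x₀ : M} {s : ℕ}
    (h : ∀ s' < s, ∀ k < K, ∀ j < b, I s' k j = J s' k j) :
    snapshot X φ rlo η b K I x₀ s = snapshot X φ rlo η b K J x₀ s := by
  induction s with
  | zero => rfl
  | succ s ih =>
    simp only [snapshot, ih fun s' hs' => h s' (hs'.trans s.lt_succ_self)]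
    exact epoch_congr (h s s.lt_succ_self)

/-- Iterates depend only on past minibatches. Hence resampling the current one leaves them
unchanged, and index values outside the sampled range are irrelevant. -/
theorem iterate_congr {η : ℝ} {b K : ℕ} {I J : ℕ → ℕ → ℕ → Fin m} {x₀ : M} {s k : ℕ}
    (h : ∀ s' < s, ∀ k < K, ∀ j < b, I s' k j = J s' k j)
    (h' : ∀ k' < k, ∀ j < b, I s k' j = J s k' j) :
    SvrRfw.iterate X φ rlo η b K I x₀ s k = SvrRfw.iterate X φ rlo η b K J x₀ s k := by
  unfold SvrRfw.iterate
  rw [snapshot_congr h, epoch_congr h']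

/-- The oracle, as a map on the model space. -/
def toracle (rlo : ∀ x : M, TangentSpace 𝓘(ℝ, E) x → M) (x : M) (g : E) : M := rlo x g

theorem iterate_succ (η : ℝ) (b K : ℕ) (I : ℕ → ℕ → ℕ → Fin m) (x₀ : M) (s k : ℕ) :
    SvrRfw.iterate X φ rlo η b K I x₀ s (k + 1)
      = geod E X (SvrRfw.iterate X φ rlo η b K I x₀ s k)
        (toracle rlo (SvrRfw.iterate X φ rlo η b K I x₀ s k)
        (tvrGrad X φ (SvrRfw.iterate X φ rlo η b K I x₀ s 0)
          (SvrRfw.iterate X φ rlo η b K I x₀ s k) b (I s k) : E)) η := rfl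

theorem iterate_epoch_succ (η : ℝ) (b K : ℕ) (I : ℕ → ℕ → ℕ → Fin m) (x₀ : M) (s : ℕ) :
    SvrRfw.iterate X φ rlo η b K I x₀ (s + 1) 0 = SvrRfw.iterate X φ rlo η b K I x₀ s K := rfl

theorem iterate_mem (hX : IsGeodesicallyConvex E X) (hr : IsRLO X rlo) {η : ℝ}
    (hη : η ∈ Icc (0 : ℝ) 1) {b K : ℕ} (I : ℕ → ℕ → ℕ → Fin m) {x₀ : M} (hx₀ : x₀ ∈ X) (s k : ℕ) :
    SvrRfw.iterate X φ rlo η b K I x₀ s k ∈ X := by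
  have hstep : ∀ s, SvrRfw.iterate X φ rlo η b K I x₀ s 0 ∈ X →
      ∀ k, SvrRfw.iterate X φ rlo η b K I x₀ s k ∈ X := by
    intro s h0 k
    induction k with
    | zero => exact h0
    | succ k ih =>
      rw [iterate_succ]
      exact (isMinGeodesic_geod hX ih (hr.mem ih _)).mapsTo hη
  refine hstep s ?_ k
  induction s with
  | zero => exact hx₀
  | succ s ih =>
    rw [iterate_epoch_succ]
    exact hstep s ih K

theorem continuousOn_objective (hφ : ∀ i, ∃ L, IsLSmoothOn E L X (φ i)) :
    ContinuousOn (objective φ) X := by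
  refine ContinuousOn.mul continuousOn_const (continuousOn_finsetSum _ fun i _ => ?_)
  obtain ⟨L, h⟩ := hφ i
  exact fun x hx => (h.1 x hx).continuousAt.continuousWithinAt

variable [IsContMDiffRiemannianBundle 𝓘(ℝ, E) ∞ E (fun x : M => TangentSpace 𝓘(ℝ, E) x)]
  [IsRiemannianManifold 𝓘(ℝ, E) M]

/-- Each step moves a fraction η of a geodesic no longer than the diameter. -/
theorem dist_iterate_le (hXc : IsCompact X) (hX : IsGeodesicallyConvex E X) (hr : IsRLO X rlo)
    {η : ℝ} (hη : η ∈ Icc (0 : ℝ) 1) {b K : ℕ} (I : ℕ → ℕ → ℕ → Fin m) {x₀ : M} (hx₀ : x₀ ∈ X)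
    (s k : ℕ) :
    dist (SvrRfw.iterate X φ rlo η b K I x₀ s 0) (SvrRfw.iterate X φ rlo η b K I x₀ s k)
      ≤ k * (η * Metric.diam X) := by
  induction k with
  | zero => simp
  | succ k ih =>
    have hx := iterate_mem (φ := φ) (b := b) (K := K) hX hr hη I hx₀ s k
    have hz : toracle rlo (SvrRfw.iterate X φ rlo η b K I x₀ s k)
        (tvrGrad X φ (SvrRfw.iterate X φ rlo η b K I x₀ s 0)
          (SvrRfw.iterate X φ rlo η b K I x₀ s k) b (I s k) : E) ∈ X := hr.mem hx _
    have h1 := (isMinGeodesic_geod hX hx hz).dist_left hη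
    have h2 := mul_le_mul_of_nonneg_left (Metric.dist_le_diam_of_mem hXc.isBounded hx hz) hη.1
    rw [iterate_succ]
    refine (dist_triangle _ (SvrRfw.iterate X φ rlo η b K I x₀ s k) _).trans ?_
    rw [h1]
    push_cast
    linarith

end Iterates

/-! ### Averaging over all samples and telescoping -/

section Samples

/-- The sample indices given by finitely many minibatches (and a default value elsewhere). -/
def extendSample {m : ℕ} (hm : 0 < m) {S K b : ℕ} (u : Fin S × Fin K → Fin b → Fin m)
    (s k j : ℕ) : Fin m :=
  if h : s < S ∧ k < K ∧ j < b then u (⟨s, h.1⟩, ⟨k, h.2.1⟩) ⟨j, h.2.2⟩ else ⟨0, hm⟩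

theorem extendSample_apply {m : ℕ} (hm : 0 < m) {S K b : ℕ} (u : Fin S × Fin K → Fin b → Fin m)
    {s k j : ℕ} (hs : s < S) (hk : k < K) (hj : j < b) :
    extendSample hm u s k j = u (⟨s, hs⟩, ⟨k, hk⟩) ⟨j, hj⟩ := dif_pos ⟨hs, hk, hj⟩

theorem extendSample_update_of_ne {m : ℕ} (hm : 0 < m) {S K b : ℕ}
    (u : Fin S × Fin K → Fin b → Fin m) (p : Fin S × Fin K) (β : Fin b → Fin m) {s k : ℕ}
    (h : s ≠ p.1 ∨ k ≠ p.2) (j : ℕ) :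
    extendSample hm (Function.update u p β) s k j = extendSample hm u s k j := by
  unfold extendSample
  split_ifs with h'
  · rw [Function.update_of_ne]
    rintro rfl
    simp at h
  · rfl

variable {E : Type*} [NormedAddCommGroup E] [NormedSpace ℝ E] [FiniteDimensional ℝ E]
  {M : Type*} [MetricSpace M] [ChartedSpace E M] [IsManifold 𝓘(ℝ, E) ∞ M]
  [RiemannianBundle (fun x : M => TangentSpace 𝓘(ℝ, E) x)]
  [IsContMDiffRiemannianBundle 𝓘(ℝ, E) ∞ E (fun x : M => TangentSpace 𝓘(ℝ, E) x)]
  [IsRiemannianManifold 𝓘(ℝ, E) M]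
  {X : Set M} {rlo : ∀ x : M, TangentSpace 𝓘(ℝ, E) x → M} {m : ℕ} {φ : Fin m → M → ℝ}

/-- The expected decrease of the objective in step `k` of epoch `s`. -/
theorem sum_objective_iterate_succ_le (hXc : IsCompact X) (hX : IsGeodesicallyConvex E X)
    (hr : IsRLO X rlo) (hm : 0 < m) {b : ℕ} (hb : 0 < b) {L : ℝ} (hL : 0 ≤ L)
    (hφ : ∀ i, IsLSmoothOn E L X (φ i)) {x₀ : M} (hx₀ : x₀ ∈ X) {K S : ℕ} {η : ℝ}
    (hη : η ∈ Icc (0 : ℝ) 1) {s k : ℕ} (hs : s < S) (hk : k < K) :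
    let x := fun (s k : ℕ) (u : Fin S × Fin K → Fin b → Fin m) =>
      SvrRfw.iterate X φ rlo η b K (extendSample hm u) x₀ s k
    ∑ u, objective φ (x s (k + 1) u) ≤ ∑ u, (objective φ (x s k u)
      - η * fwGap E X (objective φ) (x s k u)
      + L * Metric.diam X ^ 2 * η ^ 2 * (k / Real.sqrt b + 1 / 2)) := by
  intro x
  have hbR : 0 < Real.sqrt b := Real.sqrt_pos.2 (Nat.cast_pos.2 hb)
  have hmb : (0 : ℝ) < (m : ℝ) ^ b := pow_pos (Nat.cast_pos.2 hm) b
  let p : Fin S × Fin K := (⟨s, hs⟩, ⟨k, hk⟩)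
  have hmem : ∀ s k u, x s k u ∈ X := fun s k u =>
    iterate_mem hX hr hη (extendSample hm u) hx₀ s k
  -- Only minibatch `p` = (s, k) is redrawn, so the current point and its snapshot are fixed while
  -- the one-step bound is averaged over `β`.
  have hup : ∀ u β, ∀ k' ≤ k, x s k' (Function.update u p β) = x s k' u := by
    intro u β k' hk'
    refine iterate_congr (fun s' hs' k'' _ j _ => ?_) (fun k'' hk'' j _ => ?_)
    · exact extendSample_update_of_ne hm u p β (Or.inl hs'.ne) j
    · exact extendSample_update_of_ne hm u p β (Or.inr (hk''.trans_le hk').ne) j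
  have hsucc : ∀ u β, x s (k + 1) (Function.update u p β) = geod E X (x s k u)
      (toracle rlo (x s k u)
      (tvrGrad X φ (x s 0 u) (x s k u) b (extendSample hm (Function.update u p β) s k) : E)) η := by
    intro u β
    have h := iterate_succ (X := X) (φ := φ) (rlo := rlo) η b K
      (extendSample hm (Function.update u p β)) x₀ s k
    have h1 := hup u β k le_rfl
    have h2 := hup u β 0 k.zero_le
    simp only [x] at h1 h2 ⊢
    rw [h, h1, h2]
  have hone : ∀ u, ∑ β, objective φ (x s (k + 1) (Function.update u p β))
      ≤ (m : ℝ) ^ b * (objective φ (x s k u) - η * fwGap E X (objective φ) (x s k u)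
      + L * Metric.diam X ^ 2 * η ^ 2 * (k / Real.sqrt b + 1 / 2)) := by
    intro u
    simp only [hsucc]
    refine (sum_objective_step_le hXc hX hr hm hb hL hφ (hmem s 0 u) (hmem s k u)
      (I := fun β => extendSample hm (Function.update u p β) s k) (fun β j => ?_) hη).trans ?_
    · rw [extendSample_apply hm _ hs hk j.2]
      simp [p]
    · refine mul_le_mul_of_nonneg_left ?_ hmb.le
      have h1 : η * (L * dist (x s 0 u) (x s k u) / Real.sqrt b * Metric.diam X)
          ≤ η * (L * (k * (η * Metric.diam X)) / Real.sqrt b * Metric.diam X) := by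
        have := hη.1
        have hd := Metric.diam_nonneg (s := X)
        gcongr
        exact dist_iterate_le hXc hX hr hη (extendSample hm u) hx₀ s k
      have h2 : η * (L * (k * (η * Metric.diam X)) / Real.sqrt b * Metric.diam X)
          = L * Metric.diam X ^ 2 * η ^ 2 * (k / Real.sqrt b) := by ring
      linarith
  have htot := sum_sum_update p fun u => objective φ (x s (k + 1) u)
  rw [Fintype.card_fun, Fintype.card_fin, Fintype.card_fin, nsmul_eq_mul, Nat.cast_pow] at htot
  refine le_of_mul_le_mul_left ?_ hmb
  rw [← htot, Finset.mul_sum]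
  exact Finset.sum_le_sum fun u _ => hone u

/-- The bound on the Frank-Wolfe gaps, summed over all iterates and all samples. -/
theorem sum_fwGap_le (hXc : IsCompact X) (hX : IsGeodesicallyConvex E X)
    (hr : IsRLO X rlo) (hm : 0 < m) {L : ℝ} (hL : 0 ≤ L)
    (hφ : ∀ i, IsLSmoothOn E L X (φ i)) {x₀ : M} (hx₀ : x₀ ∈ X) {K S : ℕ} (hK : 0 < K) {η : ℝ}
    (hη : η ∈ Icc (0 : ℝ) 1) :
    η * ∑ u : Fin S × Fin K → Fin (K ^ 2) → Fin m, ∑ p : Fin S × Fin K,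
      fwGap E X (objective φ)
        (SvrRfw.iterate X φ rlo η (K ^ 2) K (extendSample hm u) x₀ p.1 p.2)
      ≤ Fintype.card (Fin S × Fin K → Fin (K ^ 2) → Fin m) *
        (objective φ x₀ - sInf (objective φ '' X) + L * Metric.diam X ^ 2 * (η ^ 2 * (K * S))) := by
  let x := fun (s k : ℕ) (u : Fin S × Fin K → Fin (K ^ 2) → Fin m) =>
    SvrRfw.iterate X φ rlo η (K ^ 2) K (extendSample hm u) x₀ s k
  set N : ℝ := ((Fintype.card (Fin S × Fin K → Fin (K ^ 2) → Fin m) : ℕ) : ℝ)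
  let a : ℕ → ℕ → ℝ := fun s k => ∑ u, objective φ (x s k u)
  let G : ℕ → ℕ → ℝ := fun s k => ∑ u, fwGap E X (objective φ) (x s k u)
  set c := L * Metric.diam X ^ 2 * η ^ 2 with hc
  have hc0 : 0 ≤ c := by positivity
  have hN0 : 0 ≤ N := Nat.cast_nonneg _
  have hKR : (0 : ℝ) < K := Nat.cast_pos.2 hK
  -- The batch size K² makes the drift term k/√b at most 1 throughout the epoch.
  have hsqrt : Real.sqrt ((K ^ 2 : ℕ) : ℝ) = K := by
    rw [Nat.cast_pow, Real.sqrt_sq hKR.le]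
  have hstep : ∀ s < S, ∀ k < K, η * G s k ≤ a s k - a s (k + 1) + N * (c * (k / K + 1 / 2)) := by
    intro s hs k hk
    have h := sum_objective_iterate_succ_le hXc hX hr hm (pow_pos hK 2) hL hφ hx₀ hη hs hk
    simp only [Finset.sum_add_distrib, Finset.sum_sub_distrib, ← Finset.mul_sum, Finset.sum_const,
      Finset.card_univ, nsmul_eq_mul, hsqrt] at h
    simp only [a, G, x]
    linarith
  -- The exact value is (K - 1)/2 + K/2 = K - 1/2.
  have hsumk : ∑ k ∈ Finset.range K, ((k : ℝ) / K + 1 / 2) ≤ K := by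
    have h0 : ∀ n : ℕ, ∑ k ∈ Finset.range n, (k : ℝ) = n * (n - 1) / 2 := by
      intro n
      induction n with
      | zero => simp
      | succ n ih =>
        rw [Finset.sum_range_succ, ih]
        push_cast
        ring
    have h1 : ∑ k ∈ Finset.range K, ((k : ℝ) / K + 1 / 2) = (K * (K - 1) / 2) / K + K / 2 := by
      rw [Finset.sum_add_distrib, ← Finset.sum_div, h0]
      simp
      ring
    rw [h1]
    have : (K * (K - 1) / 2 : ℝ) / K = (K - 1) / 2 := by field_simp
    rw [this]
    linarith
  have hepoch : ∀ s < S, ∑ k ∈ Finset.range K, η * G s k ≤ a s 0 - a (s + 1) 0 + N * (c * K) := by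
    intro s hs
    have h1 := Finset.sum_le_sum fun k hk => hstep s hs k (Finset.mem_range.1 hk)
    rw [Finset.sum_add_distrib, Finset.sum_range_sub'] at h1
    simp only [← Finset.mul_sum] at h1 ⊢
    have h2 : N * (c * ∑ k ∈ Finset.range K, ((k : ℝ) / K + 1 / 2)) ≤ N * (c * K) := by gcongr
    -- The last iterate of an epoch is the next snapshot, so the telescoping continues across
    -- epochs.
    have h3 : a (s + 1) 0 = a s K := rfl
    linarith
  have hall : ∑ s ∈ Finset.range S, ∑ k ∈ Finset.range K, η * G s k
      ≤ a 0 0 - a S 0 + S * (N * (c * K)) := by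
    have h1 := Finset.sum_le_sum fun s hs => hepoch s (Finset.mem_range.1 hs)
    rw [Finset.sum_add_distrib, Finset.sum_range_sub' (fun s => a s 0)] at h1
    simpa using h1
  have ha0 : a 0 0 = N * objective φ x₀ := by
    change ∑ _u : Fin S × Fin K → Fin (K ^ 2) → Fin m, objective φ x₀ = _
    rw [Finset.sum_const, Finset.card_univ, nsmul_eq_mul]
  have haS : N * sInf (objective φ '' X) ≤ a S 0 := by
    have hbdd : BddBelow (objective φ '' X) :=
      (hXc.image_of_continuousOn (continuousOn_objective fun i => ⟨L, hφ i⟩)).bddBelow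
    rw [← nsmul_eq_mul, ← Finset.card_univ, ← Finset.sum_const]
    exact Finset.sum_le_sum fun u _ => csInf_le hbdd
      (mem_image_of_mem _ (iterate_mem hX hr hη (extendSample hm u) hx₀ S 0))
  have hlhs : η * ∑ u : Fin S × Fin K → Fin (K ^ 2) → Fin m, ∑ p : Fin S × Fin K,
      fwGap E X (objective φ) (x p.1 p.2 u)
      = ∑ s ∈ Finset.range S, ∑ k ∈ Finset.range K, η * G s k := by
    rw [Finset.sum_comm, Fintype.sum_prod_type, Finset.mul_sum, Finset.sum_range]
    refine Finset.sum_congr rfl fun s _ => ?_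
    rw [Finset.mul_sum, Finset.sum_range]
  refine hlhs.le.trans (hall.trans ?_)
  rw [ha0]
  have : S * (N * (c * K)) = N * (L * Metric.diam X ^ 2 * (η ^ 2 * (K * S))) := by
    rw [hc]
    ring
  rw [this]
  linarith

end Samples

/-! ### Expectations as finite averages -/

section Probability

variable {Ω : Type*} [MeasurableSpace Ω] {P : Measure Ω} {m S K b : ℕ}
  {idx : ℕ → ℕ → ℕ → Ω → Fin m} {out : Ω → Fin S × Fin K}

/-- The minibatches drawn by the algorithm. -/
def sample (S K b : ℕ) (idx : ℕ → ℕ → ℕ → Ω → Fin m) (a : Ω) (p : Fin S × Fin K) (j : Fin b) :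
    Fin m := idx p.1 p.2 j a

theorem IsSampling.measurable_sample (h : IsSampling P m S K b idx out) :
    Measurable (sample S K b idx) :=
  measurable_pi_lambda _ fun p => measurable_pi_lambda _ fun j =>
    h.measurable_idx p.1 p.1.2 p.2 p.2.2 j j.2

/-- The output position and the minibatches are jointly uniform. -/
theorem IsSampling.real_preimage_singleton [IsProbabilityMeasure P]
    (h : IsSampling P m S K b idx out) (q : (Fin S × Fin K) × (Fin S × Fin K → Fin b → Fin m)) :
    P.real ((fun a => (out a, sample S K b idx a)) ⁻¹' {q})
      = 1 / (S * K) * (1 / Fintype.card (Fin S × Fin K → Fin b → Fin m)) := by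
  have h1 : P.real (sample S K b idx ⁻¹' {q.2})
      = 1 / Fintype.card (Fin S × Fin K → Fin b → Fin m) := by
    have hset : sample S K b idx ⁻¹' {q.2}
        = ⋂ t ∈ (Finset.univ : Finset (Fin S × Fin K × Fin b)),
          idx t.1 t.2.1 t.2.2 ⁻¹' {q.2 (t.1, t.2.1) t.2.2} := by
      ext a
      simp only [mem_preimage, mem_singleton_iff, Finset.mem_univ, iInter_true, mem_iInter,
        funext_iff, sample]
      exact ⟨fun hq t => hq (t.1, t.2.1) t.2.2, fun hq p j => hq (p.1, p.2, j)⟩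
    rw [hset, measureReal_def, h.indep_idx.measure_inter_preimage_eq_mul Finset.univ
      (sets := fun t => {q.2 (t.1, t.2.1) t.2.2}) fun t _ => measurableSet_singleton _,
      ENNReal.toReal_prod]
    have ht : ∀ t : Fin S × Fin K × Fin b,
        (P (idx t.1 t.2.1 t.2.2 ⁻¹' {q.2 (t.1, t.2.1) t.2.2})).toReal = 1 / m := fun t =>
      h.uniform_idx t.1 t.1.2 t.2.1 t.2.1.2 t.2.2 t.2.2.2 _
    simp only [ht, Finset.prod_const, Finset.card_univ, Fintype.card_prod, Fintype.card_fin,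
      Fintype.card_fun, Nat.cast_pow]
    rw [one_div_pow, ← pow_mul]
    congr 2
    ring
  have hind : IndepFun out (sample S K b idx) P :=
    h.indep_out.comp (φ := id)
      (ψ := fun (v : Fin S × Fin K × Fin b → Fin m) (p : Fin S × Fin K) j => v (p.1, p.2, j))
      measurable_id (measurable_pi_lambda _ fun p => measurable_pi_lambda _ fun j =>
        measurable_pi_apply _)
  have h2 : (fun a => (out a, sample S K b idx a)) ⁻¹' {q}
      = out ⁻¹' {q.1} ∩ sample S K b idx ⁻¹' {q.2} := by
    ext a
    simp [Prod.ext_iff]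
  rw [h2, measureReal_def, hind.measure_inter_preimage_eq_mul _ _ (measurableSet_singleton _)
    (measurableSet_singleton _), ENNReal.toReal_mul]
  exact congrArg₂ _ (h.uniform_out q.1) h1

/-- Expectations over the randomness of the algorithm are finite averages. -/
theorem IsSampling.integral_eq [IsProbabilityMeasure P] (h : IsSampling P m S K b idx out)
    (f : Fin S × Fin K → (Fin S × Fin K → Fin b → Fin m) → ℝ) :
    Integrable (fun a => f (out a) (sample S K b idx a)) P ∧
    ∫ a, f (out a) (sample S K b idx a) ∂P
      = 1 / (S * K) * (1 / Fintype.card (Fin S × Fin K → Fin b → Fin m)) *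
        ∑ u, ∑ p, f p u := by
  let T : Ω → (Fin S × Fin K) × (Fin S × Fin K → Fin b → Fin m) :=
    fun a => (out a, sample S K b idx a)
  have hT : Measurable T := h.measurable_out.prodMk h.measurable_sample
  let g : (Fin S × Fin K) × (Fin S × Fin K → Fin b → Fin m) → ℝ := fun q => f q.1 q.2
  have : IsProbabilityMeasure (P.map T) := Measure.isProbabilityMeasure_map hT.aemeasurable
  -- The law of (output, samples) lives on a finite space, where every real function is integrable.
  have hg : Integrable g (P.map T) := Integrable.of_finite
  refine ⟨hg.comp_measurable hT, ?_⟩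
  have h1 : ∫ a, f (out a) (sample S K b idx a) ∂P = ∫ q, g q ∂(P.map T) :=
    (integral_map hT.aemeasurable hg.aestronglyMeasurable).symm
  rw [h1, integral_fintype hg]
  have h2 : ∀ q, (P.map T).real {q}
      = 1 / (S * K) * (1 / Fintype.card (Fin S × Fin K → Fin b → Fin m)) := fun q => by
    rw [map_measureReal_apply hT (measurableSet_singleton q)]
    exact h.real_preimage_singleton q
  simp only [h2, smul_eq_mul, ← Finset.mul_sum]
  rw [Fintype.sum_prod_type, Finset.sum_comm]

end Probability

/-! ### The sign of the smoothness constant -/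

section Reduction

variable {E : Type*} [NormedAddCommGroup E] [NormedSpace ℝ E] [FiniteDimensional ℝ E]
  {M : Type*} [MetricSpace M] [ChartedSpace E M] [IsManifold 𝓘(ℝ, E) ∞ M]
  [RiemannianBundle (fun x : M => TangentSpace 𝓘(ℝ, E) x)]
  {X : Set M}

/-- A negative smoothness constant can be replaced by zero. -/
theorem exists_nonneg_isLSmoothOn {m : ℕ} (hm : 0 < m) {φ : Fin m → M → ℝ} {L : ℝ}
    (h : ∀ i, IsLSmoothOn E L X (φ i)) :
    ∃ L' : ℝ, 0 ≤ L' ∧ (∀ i, IsLSmoothOn E L' X (φ i)) ∧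
      L' * Metric.diam X ^ 2 = L * Metric.diam X ^ 2 := by
  rcases le_or_gt 0 L with hL | hL
  · exact ⟨L, hL, h, rfl⟩
  -- For L < 0 a nonnegative norm is bounded by L·d, which forces d = 0. Thus the diameter vanishes
  -- and the term LD² is unaffected.
  have hd : ∀ x ∈ X, ∀ y ∈ X, dist x y = 0 := by
    intro x hx y hy
    have h1 : 0 ≤ L * dist x y := (norm_nonneg _).trans ((h ⟨0, hm⟩).2 x hx y hy)
    nlinarith [dist_nonneg (x := x) (y := y)]
  have hD : Metric.diam X = 0 :=
    le_antisymm (Metric.diam_le_of_forall_dist_le le_rfl fun x hx y hy => (hd x hx y hy).le)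
      Metric.diam_nonneg
  refine ⟨0, le_rfl, fun i => ⟨(h i).1, fun x hx y hy => ?_⟩, by simp [hD]⟩
  have := (h i).2 x hx y hy
  rw [hd x hx y hy, mul_zero] at this ⊢
  exact this

end Reduction

end SvrRfw

end

/-! ### The convergence rate -/

theorem mainTheorem2
    {E : Type*} [NormedAddCommGroup E] [NormedSpace ℝ E] [FiniteDimensional ℝ E]
    {M : Type*} [MetricSpace M] [ChartedSpace E M] [IsManifold 𝓘(ℝ, E) ∞ M]
    [RiemannianBundle (fun x : M => TangentSpace 𝓘(ℝ, E) x)]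
    [IsContMDiffRiemannianBundle 𝓘(ℝ, E) ∞ E (fun x : M => TangentSpace 𝓘(ℝ, E) x)]
    [IsRiemannianManifold 𝓘(ℝ, E) M]
    (X : Set M) (hXc : IsCompact X) (hXg : SvrRfw.IsGeodesicallyConvex E X)
    {m : ℕ} (hm : 0 < m) (φ : Fin m → M → ℝ) (L : ℝ)
    (hφ : ∀ i, SvrRfw.IsLSmoothOn E L X (φ i))
    (rlo : ∀ x : M, TangentSpace 𝓘(ℝ, E) x → M) (hrlo : SvrRfw.IsRLO X rlo)
    (x₀ : M) (hx₀ : x₀ ∈ X)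
    (K S : ℕ) (hK : 0 < K) (hS : 0 < S)
    {Ω : Type*} [MeasurableSpace Ω] (P : Measure Ω) [IsProbabilityMeasure P]
    (idx : ℕ → ℕ → ℕ → Ω → Fin m) (out : Ω → Fin S × Fin K)
    (hsamp : SvrRfw.IsSampling P m S K (K ^ 2) idx out) :
    let Φ : M → ℝ := SvrRfw.objective φ
    let η : ℝ := 1 / Real.sqrt (K * S)
    let xhat : Ω → M := fun a =>
      SvrRfw.iterate X φ rlo η (K ^ 2) K (fun s k j => idx s k j a) x₀ (out a).1 (out a).2
    Integrable (fun a => SvrRfw.fwGap E X Φ (xhat a)) P ∧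
    ∫ a, SvrRfw.fwGap E X Φ (xhat a) ∂P ≤
      (Φ x₀ - sInf (Φ '' X) + L * Metric.diam X ^ 2) / Real.sqrt (K * S) := by
  intro Φ η xhat
  have hKR : (1 : ℝ) ≤ K := by exact_mod_cast hK
  have hSR : (1 : ℝ) ≤ S := by exact_mod_cast hS
  have hKS : (1 : ℝ) ≤ K * S := one_le_mul_of_one_le_of_one_le hKR hSR
  have hKS0 : (0 : ℝ) < K * S := zero_lt_one.trans_le hKS
  have hsq : 1 ≤ Real.sqrt (K * S) := Real.one_le_sqrt.2 hKS
  have hsq0 : 0 < Real.sqrt (K * S) := zero_lt_one.trans_le hsq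
  -- KS ≥ 1 keeps the step on the geodesic, hence every iterate in `X`.
  have hη : η ∈ Icc (0 : ℝ) 1 := ⟨by positivity, (div_le_one hsq0).2 hsq⟩
  have hη2 : η ^ 2 * (K * S) = 1 := by
    simp only [η]
    rw [div_pow, one_pow, Real.sq_sqrt hKS0.le, one_div_mul_cancel hKS0.ne']
  obtain ⟨L', hL', hφ', hLD⟩ := SvrRfw.exists_nonneg_isLSmoothOn hm hφ
  have hx : ∀ a, xhat a = SvrRfw.iterate X φ rlo η (K ^ 2) K
      (SvrRfw.extendSample hm (SvrRfw.sample S K (K ^ 2) idx a)) x₀ (out a).1 (out a).2 := by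
    intro a
    refine SvrRfw.iterate_congr (fun s hs k hk j hj => ?_) (fun k hk j hj => ?_)
    · rw [SvrRfw.extendSample_apply hm _ (hs.trans (out a).1.2) hk hj]
      rfl
    · rw [SvrRfw.extendSample_apply hm _ (out a).1.2 (hk.trans (out a).2.2) hj]
      rfl
  obtain ⟨hint, heq⟩ := hsamp.integral_eq fun p u => SvrRfw.fwGap E X Φ
    (SvrRfw.iterate X φ rlo η (K ^ 2) K (SvrRfw.extendSample hm u) x₀ p.1 p.2)
  simp only [hx]
  refine ⟨hint, heq.le.trans ?_⟩
  have hsum := SvrRfw.sum_fwGap_le hXc hXg hrlo hm hL' hφ' hx₀ (S := S) hK hη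
  rw [hη2, mul_one, hLD] at hsum
  have : Nonempty (Fin m) := ⟨⟨0, hm⟩⟩
  have hN : (0 : ℝ) < (Fintype.card (Fin S × Fin K → Fin (K ^ 2) → Fin m) : ℕ) :=
    Nat.cast_pos.2 Fintype.card_pos
  rw [div_mul_div_comm, one_mul, div_mul_eq_mul_div, one_mul, div_le_iff₀ (by positivity)]
  have hηs : η * Real.sqrt (K * S) = 1 := one_div_mul_cancel hsq0.ne'
  have hss : Real.sqrt (K * S) * Real.sqrt (K * S) = K * S := Real.mul_self_sqrt hKS0.le
  -- Multiplying by √(KS) = 1/η isolates the sum of the gaps; the uniform weight 1/(KS) then leaves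
  -- 1/√(KS).
  have h1 := mul_le_mul_of_nonneg_left hsum hsq0.le
  rw [← mul_assoc, mul_comm _ η, hηs, one_mul] at h1
  refine h1.trans (le_of_eq ?_)
  rw [div_mul_eq_mul_div, eq_div_iff hsq0.ne']
  linear_combination (Fintype.card (Fin S × Fin K → Fin (K ^ 2) → Fin m) : ℝ)
    * (Φ x₀ - sInf (Φ '' X) + L * Metric.diam X ^ 2) * hss
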